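/- Let $m,g,l,\bar q_a>0$. For $I\in\mathbb R$ consider on the cylinder $\mathbb S^1\times\mathbb R\ni(q_u,p_u)$ the constrained acrobot dynamics $$\dot q_u=\frac{(1+I^2p_u^2)p_u+m^2gl^3\bar q_a I\,(2\sin q_u+\sin(q_u+q_a))(1+\cos q_a)}{ml^2(1+I^2p_u^2)(3+2\cos q_a)},\qquad \dot p_u=-mgl\,(2\sin q_u+\sin(q_u+q_a)),$$ where $q_a=\bar q_a\arctan(Ip_u)$, and denote by $x(t,x_0)$ its solution with $x(0,x_0)=x_0$. Let $$E(q_u,p_u)=\frac{p_u^2}{10ml^2}+3mgl(1-\cos q_u),\qquad \bar R=E(\pi,0),$$ $E_R=\{E=R\}$, $E_{[R_1,R_2]}=\{R_1\le E\le R_2\}$ and $\mathcal P_r=\{(q_u,p_u): E(q_u,p_u)>\bar R,\ q_u=0\}$. A solution $x(t,x_0)$ is a *rotation over $[0,\bar t]$* if $x([0,\bar t],x_0)\cap\mathcal P_r$ is a discrete set. It *gains* (resp. *loses*) *energy over $[0,\bar t]$* if the times in $[0,\bar t]$ at which it lies in $\mathcal P_r$ form a finite (possibly empty) sequence $t^1<t^2<\cdots$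 and the sequence $\|x(t^i,x_0)\|$ is strictly increasing (resp. strictly decreasing). Put $C=m^2gl^3\bar q_a$, $$b(r,\theta)=\frac{5C\left(\frac{C}{\bar q_a}\left(18\sin^2\theta+30\cos\theta(1-\cos\theta)\right)-r^2\cos\theta\right)}{|r|\sqrt{r^2-30m^2gl^3(1-\cos\theta)}},\qquad S(r)=\int_0^{2\pi}b(r,\theta)\,d\theta .$$ **Theorem (rotations gaining/losing energy).** Let $\bar R<R_1<R_2$, and suppose that there is $\varepsilon>0$ such that $S(r)\ge\varepsilon$ for all $r\in[(10ml^2R_1)^{1/2},(10ml^2R_2)^{1/2}]$. Then there is $I^\star>0$ such that for each $I\in(0,I^\star]$ (resp. $I\in[-I^\star,0)$) and each $x_0\in E_{[R_1,R_2]}$, the solution $x(t,x_0)$ exists for all $t\in\mathbb R$ and is unique, and there is $\bar t\ge0$ such that $x(\bar t,x_0)\in E_{R_2}$ (resp. $x(\bar t,x_0)\in E_{R_1}$) and $x(t,x_0)$ is a rotation gaining (resp. losing) energy over $[0,\bar t]$. -/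

import Mathlib

/-- Physical parameters of the simplified acrobot (two rods of length `l` with point masses `m`
at the tips, gravity `g`), together with the gain `qbar` of the virtual constraint. -/
structure AcrobotParams where
  m : ℝ
  g : ℝ
  l : ℝ
  qbar : ℝ
  m_pos : 0 < m
  g_pos : 0 < g
  l_pos : 0 < l
  qbar_pos : 0 < qbar

namespace AcrobotParams

/-- States `(q_u, p_u)` of the constrained dynamics: the cylinder `S¹ × ℝ`. -/
abbrev State : Type := Real.Angle × ℝ

/-- The leg angle prescribed by the constraint `q_a = qbar * arctan (I * p_u)`. -/
noncomputable def legAngle (P : AcrobotParams) (I p : ℝ) : ℝ :=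
  P.qbar * Real.arctan (I * p)

/-- Right-hand side of the equation for `q_u` in the constrained dynamics. It is `2π`-periodic
in `q`. -/
noncomputable def qDot (P : AcrobotParams) (I q p : ℝ) : ℝ :=
  ((1 + I ^ 2 * p ^ 2) * p
      + P.m ^ 2 * P.g * P.l ^ 3 * P.qbar * I
        * (2 * Real.sin q + Real.sin (q + P.legAngle I p)) * (1 + Real.cos (P.legAngle I p)))
    / (P.m * P.l ^ 2 * (1 + I ^ 2 * p ^ 2) * (3 + 2 * Real.cos (P.legAngle I p)))

/-- Right-hand side of the equation for `p_u` in the constrained dynamics. It is `2π`-periodic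
in `q`. -/
noncomputable def pDot (P : AcrobotParams) (I q p : ℝ) : ℝ :=
  -(P.m * P.g * P.l * (2 * Real.sin q + Real.sin (q + P.legAngle I p)))

/-- `x` is a solution, defined for all times, of the constrained dynamics on the cylinder with
initial condition `x 0 = x₀`. Derivatives on the circle are taken along a real-valued lift `q` of
the angle; every differentiable curve in the circle has one. -/
def IsSolution (P : AcrobotParams) (I : ℝ) (x₀ : State) (x : ℝ → State) : Prop :=
  x 0 = x₀ ∧
    ∃ q p : ℝ → ℝ,
      (∀ t, x t = ((q t : Real.Angle), p t)) ∧
      (∀ t, HasDerivAt q (P.qDot I (q t) (p t)) t) ∧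
      (∀ t, HasDerivAt p (P.pDot I (q t) (p t)) t)

/-- Mechanical energy of the nominal pendulum (legs fully extended). -/
noncomputable def energy (P : AcrobotParams) (x : State) : ℝ :=
  x.2 ^ 2 / (10 * P.m * P.l ^ 2) + 3 * P.m * P.g * P.l * (1 - Real.Angle.cos x.1)

/-- The critical energy `E(π, 0)`, separating oscillations from rotations. -/
noncomputable def Rbar (P : AcrobotParams) : ℝ :=
  P.energy ((Real.pi : Real.Angle), 0)

/-- The level set `E_R`. -/
def energyLevel (P : AcrobotParams) (R : ℝ) : Set State :=
  {x | P.energy x = R}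

/-- The set `E_[R₁, R₂]`. -/
def energyBand (P : AcrobotParams) (R₁ R₂ : ℝ) : Set State :=
  {x | R₁ ≤ P.energy x ∧ P.energy x ≤ R₂}

/-- The Poincaré section for rotations: energy above `Rbar` and `q_u = 0` (mod `2π`). -/
def rotationSection (P : AcrobotParams) : Set State :=
  {x | P.Rbar < P.energy x ∧ x.1 = 0}

/-- Euclidean norm of `(q_u, p_u)`, with `q_u` represented in `(-π, π]`. -/
noncomputable def stateNorm (x : State) : ℝ :=
  Real.sqrt (x.1.toReal ^ 2 + x.2 ^ 2)

/-- The curve `x` is a rotation over `[0, T]`. -/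
def IsRotation (P : AcrobotParams) (x : ℝ → State) (T : ℝ) : Prop :=
  IsDiscrete (x '' Set.Icc 0 T ∩ P.rotationSection)

/-- The strictly increasing finite sequence `t` lists exactly the times in `[0, T]` at which `x`
meets the Poincaré section. -/
def IsCrossingSequence (P : AcrobotParams) (x : ℝ → State) (T : ℝ) {n : ℕ} (t : Fin n → ℝ) :
    Prop :=
  StrictMono t ∧ Set.range t = {s | s ∈ Set.Icc 0 T ∧ x s ∈ P.rotationSection}

/-- `x` is a rotation gaining energy over `[0, T]`. -/
def IsRotationGainingEnergy (P : AcrobotParams) (x : ℝ → State) (T : ℝ) : Prop :=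
  P.IsRotation x T ∧
    ∃ (n : ℕ) (t : Fin n → ℝ), P.IsCrossingSequence x T t ∧
      StrictMono (fun i => stateNorm (x (t i)))

/-- `x` is a rotation losing energy over `[0, T]`. -/
def IsRotationLosingEnergy (P : AcrobotParams) (x : ℝ → State) (T : ℝ) : Prop :=
  P.IsRotation x T ∧
    ∃ (n : ℕ) (t : Fin n → ℝ), P.IsCrossingSequence x T t ∧
      StrictAnti (fun i => stateNorm (x (t i)))

/-- The constant `C = m² g l³ qbar`. -/
noncomputable def C (P : AcrobotParams) : ℝ :=
  P.m ^ 2 * P.g * P.l ^ 3 * P.qbar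

/-- The function `b(r, θ)`. -/
noncomputable def b (P : AcrobotParams) (r θ : ℝ) : ℝ :=
  5 * P.C *
      (P.C / P.qbar * (18 * Real.sin θ ^ 2 + 30 * Real.cos θ * (1 - Real.cos θ))
        - Real.cos θ * r ^ 2)
    / (|r| * Real.sqrt (r ^ 2 - 30 * P.m ^ 2 * P.g * P.l ^ 3 * (1 - Real.cos θ)))

/-- The function `S(r) = ∫₀^{2π} b(r, θ) dθ`. -/
noncomputable def S (P : AcrobotParams) (r : ℝ) : ℝ :=
  ∫ θ in (0 : ℝ)..(2 * Real.pi), P.b r θ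

end AcrobotParams

section

open Set Filter Topology MeasureTheory Asymptotics

/-! The proof is first-order averaging over one turn. The level `W = levelSq` is a rescaled energy,
conserved when `I = 0`. Uniformly in `q` and in bounded `p`, `exists_field_bounds` gives `W' = 2 I
gainRate / k + o(I)` and `q' = p / k + o(1)`, with `k = 5 m l²`. On a rotation with `p > 0`,
`gainRate = p G`, where `G = angularGain` is the gain per unit angle; so `W'` is `2 I G q'` to first
order, and by `integral_angularGain` the integral of `G` over a turn is `√w S(√w) > 0`.

Subtracting from `W` the product of `2 I` with a periodic primitive of `G` minus its mean removes
the oscillation. The corrected level `V` satisfies `|V - W| ≤ K |I|`, and `I V` grows at rate at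
least `κ I²` (`exists_drift_bounds`). Working in a slightly wider band, `exists_hitting_time` then
forces `W` to reach the target level without leaving that band. The primitive vanishes at multiples
of `2π`, so `V = W` exactly on the section, and strict monotonicity of `I V` passes to the crossings
with no error term. The factor `I` treats both signs at once; the symmetry `(q, p) ↦ (-q, -p)`
covers negative momentum. -/

/-! ### Global integral curves of `C¹` fields. -/

theorem hasMFDerivAt_smulRight_iff_hasDerivAt {E : Type*} [NormedAddCommGroup E]
    [NormedSpace ℝ E] (F : E → E) {γ : ℝ → E} {t : ℝ} :
    HasMFDerivAt (modelWithCornersSelf ℝ ℝ) (modelWithCornersSelf ℝ E) γ t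
      ((1 : ℝ →L[ℝ] ℝ).smulRight (F (γ t))) ↔ HasDerivAt γ (F (γ t)) t := by
  have h : HasFDerivAt γ ((1 : ℝ →L[ℝ] ℝ).smulRight (F (γ t))) t ↔
      HasDerivAt γ (F (γ t)) t := by
    rw [hasDerivAt_iff_hasFDerivAt]
    congr!
  exact hasMFDerivAt_iff_hasFDerivAt.trans h

/-- A `C¹` vector field of at most linear growth has global integral curves. -/
theorem exists_forall_hasDerivAt_of_linear_growth {E : Type*} [NormedAddCommGroup E]
    [NormedSpace ℝ E] [FiniteDimensional ℝ E] {F : E → E} (hF : ContDiff ℝ 1 F) {A B : ℝ}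
    (hA : 0 ≤ A) (hB : 0 ≤ B) (hgrowth : ∀ x, ‖F x‖ ≤ A + B * ‖x‖) (x₀ : E) :
    ∃ γ : ℝ → E, γ 0 = x₀ ∧ ∀ t, HasDerivAt γ (F (γ t)) t := by
  have hcomplete : CompleteSpace E := FiniteDimensional.complete ℝ E
  have hproper : ProperSpace E := FiniteDimensional.proper ℝ E
  -- This existence time does not depend on the starting point: the radius `a` chosen below grows
  -- with `‖x‖` as fast as the speed bound `L ≤ (1 + B) a`. Such a uniform time is what allows local
  -- curves to be glued into a global one.
  set ε : ℝ := 1 / (2 * (B + 1)) with hε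
  have hεpos : 0 < ε := by positivity
  have key : ∀ x : E, ∃ γ : ℝ → E, γ 0 = x ∧
      ∀ t ∈ Ioo (-ε) ε, HasDerivAt γ (F (γ t)) t := by
    intro x
    set a : ℝ := A + B * ‖x‖ + 1 with ha
    have ha0 : 0 ≤ a := by positivity
    obtain ⟨K, hK⟩ := (hF.locallyLipschitz.locallyLipschitzOn (s := Metric.closedBall x a)
      ).exists_lipschitzOnWith_of_compact (isCompact_closedBall x a)
    set L : ℝ := A + B * (‖x‖ + a) with hL
    have hL0 : 0 ≤ L := by positivity
    have hb : ∀ y ∈ Metric.closedBall x a, ‖F y‖ ≤ L := by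
      intro y hy
      have h1 : ‖y‖ ≤ ‖x‖ + a := by
        have := norm_le_norm_add_norm_sub' y x
        rw [mem_closedBall_iff_norm] at hy
        linarith
      exact (hgrowth y).trans (by rw [hL]; gcongr)
    have htime : L * ε ≤ a := by
      rw [hε, mul_one_div, div_le_iff₀ (by positivity)]
      have : 0 ≤ B * ‖x‖ := by positivity
      nlinarith [mul_nonneg hB ha0]
    have hpl : IsPicardLindelof (fun _ ↦ F) (tmin := -ε) (tmax := ε)
        ⟨0, by constructor <;> linarith⟩ x ⟨a, ha0⟩ 0 ⟨L, hL0⟩ K := by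
      apply IsPicardLindelof.of_time_independent hb hK
      simpa [hεpos.le] using! htime
    obtain ⟨α, hα, hα'⟩ := hpl.exists_eq_forall_mem_Icc_hasDerivWithinAt₀
    exact ⟨α, hα, fun t ht ↦ (hα' t (Ioo_subset_Icc_self ht)).hasDerivAt
      (Icc_mem_nhds ht.1 ht.2)⟩
  obtain ⟨γ, h0, hγ⟩ := exists_isMIntegralCurve_of_isMIntegralCurveOn
    (I := modelWithCornersSelf ℝ E) (v := F) (contMDiff_vectorSpace_iff_contDiff.2 hF) hεpos
    (fun x ↦ by
      obtain ⟨γ, h0, hγ⟩ := key x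
      refine ⟨γ, h0, ?_⟩
      exact fun t ht ↦ ((hasMFDerivAt_smulRight_iff_hasDerivAt F).2 (hγ t ht)).hasMFDerivWithinAt)
    x₀
  exact ⟨γ, h0, fun t ↦ (hasMFDerivAt_smulRight_iff_hasDerivAt F).1 (hγ t)⟩

/-- Global integral curves of a `C¹` vector field are determined by one value. -/
theorem eq_of_forall_hasDerivAt_of_contDiff {E : Type*} [NormedAddCommGroup E]
    [NormedSpace ℝ E] [CompleteSpace E] {F : E → E} (hF : ContDiff ℝ 1 F) {γ γ' : ℝ → E}
    (hγ : ∀ t, HasDerivAt γ (F (γ t)) t) (hγ' : ∀ t, HasDerivAt γ' (F (γ' t)) t) {t₀ : ℝ}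
    (h : γ t₀ = γ' t₀) : γ = γ' := by
  apply isMIntegralCurve_Ioo_eq_of_contMDiff_boundaryless (I := modelWithCornersSelf ℝ E)
    (v := F) (contMDiff_vectorSpace_iff_contDiff.2 hF) _ _ h
  · exact fun t ↦ (hasMFDerivAt_smulRight_iff_hasDerivAt F).2 (hγ t)
  · exact fun t ↦ (hasMFDerivAt_smulRight_iff_hasDerivAt F).2 (hγ' t)

/-! ### Existence and uniqueness for the constrained dynamics. -/

namespace AcrobotParams

variable (P : AcrobotParams)

/-- The constrained dynamics as a vector field on the universal cover `ℝ × ℝ` of the cylinder. -/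
noncomputable def liftedField (I : ℝ) (z : ℝ × ℝ) : ℝ × ℝ :=
  (P.qDot I z.1 z.2, P.pDot I z.1 z.2)

theorem qDot_denom_pos (I p : ℝ) :
    0 < P.m * P.l ^ 2 * (1 + I ^ 2 * p ^ 2) * (3 + 2 * Real.cos (P.legAngle I p)) := by
  have h1 := Real.neg_one_le_cos (P.legAngle I p)
  have hm := P.m_pos
  have hl := P.l_pos
  have : 0 < 3 + 2 * Real.cos (P.legAngle I p) := by linarith
  positivity

theorem contDiff_liftedField (I : ℝ) : ContDiff ℝ 1 (P.liftedField I) := by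
  have hleg : ContDiff ℝ 1 fun z : ℝ × ℝ ↦ P.legAngle I z.2 := by
    unfold legAngle
    exact contDiff_const.mul (Real.contDiff_arctan.comp (contDiff_const.mul contDiff_snd))
  unfold liftedField
  apply ContDiff.prodMk
  · unfold qDot
    refine ContDiff.fun_div ?_ ?_ (fun z ↦ (P.qDot_denom_pos I z.2).ne') <;> fun_prop
  · unfold pDot
    fun_prop

theorem abs_two_sin_add_sin_le (q a : ℝ) : |2 * Real.sin q + Real.sin (q + a)| ≤ 3 := by
  rw [abs_le]
  constructor <;>
    linarith [Real.neg_one_le_sin q, Real.sin_le_one q, Real.neg_one_le_sin (q + a),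
      Real.sin_le_one (q + a)]

/-- Both `3 + 2 cos` and `1 + I² p²` are at least `1`, so every term is bounded except the one
linear in `p`. This is the growth condition for global existence. -/
theorem norm_liftedField_le (I : ℝ) (z : ℝ × ℝ) :
    ‖P.liftedField I z‖ ≤ (6 * P.C * |I| / (P.m * P.l ^ 2) + 3 * (P.m * P.g * P.l))
      + 1 / (P.m * P.l ^ 2) * ‖z‖ := by
  obtain ⟨q, p⟩ := z
  have hm := P.m_pos
  have hl := P.l_pos
  have hg := P.g_pos
  have hC : 0 < P.C := by unfold C; have := P.qbar_pos; positivity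
  have hp : |p| ≤ ‖(q, p)‖ := norm_snd_le (q, p)
  have hs := abs_two_sin_add_sin_le q (P.legAngle I p)
  set s := 2 * Real.sin q + Real.sin (q + P.legAngle I p) with hsdef
  have hc := Real.neg_one_le_cos (P.legAngle I p)
  have hc' := Real.cos_le_one (P.legAngle I p)
  rw [Prod.norm_def, max_le_iff]
  constructor
  · have hq : P.qDot I q p = p / (3 + 2 * Real.cos (P.legAngle I p)) / (P.m * P.l ^ 2)
        + P.C * I * s * ((1 + Real.cos (P.legAngle I p)) /
          ((1 + I ^ 2 * p ^ 2) * (3 + 2 * Real.cos (P.legAngle I p)))) / (P.m * P.l ^ 2) := by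
      have h3 : 3 + 2 * Real.cos (P.legAngle I p) ≠ 0 := by linarith
      have h4 : 1 + I ^ 2 * p ^ 2 ≠ 0 := by positivity
      unfold qDot C
      rw [← hsdef]
      field_simp
    have h1 : |p / (3 + 2 * Real.cos (P.legAngle I p))| ≤ ‖(q, p)‖ := by
      rw [abs_div, abs_of_pos (by linarith : (0 : ℝ) < 3 + 2 * Real.cos (P.legAngle I p))]
      exact (div_le_self (abs_nonneg p) (by linarith)).trans hp
    have h2 : |(1 + Real.cos (P.legAngle I p)) /
          ((1 + I ^ 2 * p ^ 2) * (3 + 2 * Real.cos (P.legAngle I p)))| ≤ 2 := by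
      have hd : 1 ≤ (1 + I ^ 2 * p ^ 2) * (3 + 2 * Real.cos (P.legAngle I p)) :=
        one_le_mul_of_one_le_of_one_le (by nlinarith [sq_nonneg (I * p)]) (by linarith)
      rw [abs_of_nonneg (div_nonneg (by linarith) (by linarith))]
      exact (div_le_self (by linarith) hd).trans (by linarith)
    have h3 : |P.C * I * s * ((1 + Real.cos (P.legAngle I p)) /
          ((1 + I ^ 2 * p ^ 2) * (3 + 2 * Real.cos (P.legAngle I p))))| ≤ P.C * |I| * 3 * 2 := by
      rw [abs_mul, abs_mul, abs_mul, abs_of_pos hC]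
      gcongr
    have hk : 0 < P.m * P.l ^ 2 := by positivity
    change |P.qDot I q p| ≤ _
    calc |P.qDot I q p| ≤ ‖(q, p)‖ / (P.m * P.l ^ 2) + P.C * |I| * 3 * 2 / (P.m * P.l ^ 2) := by
          rw [hq]
          refine (abs_add_le _ _).trans (add_le_add ?_ ?_)
          · rw [abs_div, abs_of_pos hk]
            gcongr
          · rw [abs_div, abs_of_pos hk]
            gcongr
      _ ≤ _ := by
          have : 0 ≤ 3 * (P.m * P.g * P.l) := by positivity
          have e : ‖(q, p)‖ / (P.m * P.l ^ 2) + P.C * |I| * 3 * 2 / (P.m * P.l ^ 2)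
              = 6 * P.C * |I| / (P.m * P.l ^ 2) + 1 / (P.m * P.l ^ 2) * ‖(q, p)‖ := by ring
          linarith
  · change |P.pDot I q p| ≤ _
    unfold pDot
    rw [abs_neg, abs_mul, abs_of_pos (by positivity : 0 < P.m * P.g * P.l)]
    have h5 : P.m * P.g * P.l * |s| ≤ 3 * (P.m * P.g * P.l) := by
      rw [mul_comm]; gcongr
    have h6 : 0 ≤ 6 * P.C * |I| / (P.m * P.l ^ 2) := by positivity
    have h7 : 0 ≤ 1 / (P.m * P.l ^ 2) * ‖(q, p)‖ := by positivity
    linarith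

theorem exists_isSolution (I : ℝ) (x₀ : State) : ∃ x, P.IsSolution I x₀ x := by
  obtain ⟨θ, p₀⟩ := x₀
  induction θ using Real.Angle.induction_on with
  | _ q₀ =>
  have hm := P.m_pos
  have hl := P.l_pos
  have hg := P.g_pos
  have hC : 0 < P.C := by unfold C; have := P.qbar_pos; positivity
  obtain ⟨γ, h0, hγ⟩ := exists_forall_hasDerivAt_of_linear_growth (P.contDiff_liftedField I)
    (by positivity) (by positivity) (P.norm_liftedField_le I) (q₀, p₀)
  refine ⟨fun t ↦ (((γ t).1 : Real.Angle), (γ t).2), by simp [h0], fun t ↦ (γ t).1,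
    fun t ↦ (γ t).2, fun t ↦ rfl, fun t ↦ ?_, fun t ↦ ?_⟩
  · exact (hasFDerivAt_fst.comp_hasDerivAt t (hγ t))
  · exact (hasFDerivAt_snd.comp_hasDerivAt t (hγ t))

theorem qDot_add_int_mul_two_pi (I q p : ℝ) (n : ℤ) :
    P.qDot I (q + n * (2 * Real.pi)) p = P.qDot I q p := by
  unfold qDot
  rw [Real.sin_add_int_mul_two_pi, add_right_comm, Real.sin_add_int_mul_two_pi]

theorem pDot_add_int_mul_two_pi (I q p : ℝ) (n : ℤ) :
    P.pDot I (q + n * (2 * Real.pi)) p = P.pDot I q p := by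
  unfold pDot
  rw [Real.sin_add_int_mul_two_pi, add_right_comm, Real.sin_add_int_mul_two_pi]

/-- Two lifts start a multiple of `2π` apart. The field is `2π`-periodic in `q`, so shifting one
lift by that multiple gives another integral curve with the same start, and uniqueness on the plane
applies. -/
theorem IsSolution.unique {P : AcrobotParams} {I : ℝ} {x₀ : State} {x y : ℝ → State}
    (hx : P.IsSolution I x₀ x) (hy : P.IsSolution I x₀ y) : x = y := by
  obtain ⟨hx0, q, p, hxe, hq, hp⟩ := hx
  obtain ⟨hy0, q', p', hye, hq', hp'⟩ := hy
  have h0 : ((q 0 : Real.Angle), p 0) = ((q' 0 : Real.Angle), p' 0) := by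
    rw [← hxe, ← hye, hx0, hy0]
  obtain ⟨h1, h2⟩ := Prod.ext_iff.1 h0
  obtain ⟨n, hn⟩ := Real.Angle.angle_eq_iff_two_pi_dvd_sub.1 h1
  have heq : (fun t ↦ (q t, p t)) = fun t ↦ (q' t + n * (2 * Real.pi), p' t) := by
    refine eq_of_forall_hasDerivAt_of_contDiff (P.contDiff_liftedField I) (t₀ := 0)
      (fun t ↦ (hq t).prodMk (hp t)) (fun t ↦ ?_) ?_
    · unfold liftedField
      simp only [qDot_add_int_mul_two_pi, pDot_add_int_mul_two_pi]
      exact ((hq' t).add_const _).prodMk (hp' t)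
    · refine Prod.ext ?_ h2
      simp only
      linarith
  funext t
  have ht := congrFun heq t
  simp only [Prod.mk.injEq] at ht
  rw [hxe, hye, ht.1, ht.2]
  congr 1
  rw [Real.Angle.angle_eq_iff_two_pi_dvd_sub]
  exact ⟨n, by ring⟩

theorem existsUnique_isSolution (I : ℝ) (x₀ : State) : ∃! x, P.IsSolution I x₀ x := by
  obtain ⟨x, hx⟩ := P.exists_isSolution I x₀
  exact ⟨x, hx, fun y hy ↦ hy.unique hx⟩

end AcrobotParams

/-! ### Mean-free primitives of periodic functions depending on a parameter. -/

/-- The primitive in `q`, from `0`, of `f y` minus its mean over a period. -/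
noncomputable def periodicPrimitive (f : ℝ → ℝ → ℝ) (y q : ℝ) : ℝ :=
  (∫ θ in (0 : ℝ)..q, f y θ) - q / (2 * Real.pi) * ∫ θ in (0 : ℝ)..(2 * Real.pi), f y θ

section PeriodicPrimitive

variable {f : ℝ → ℝ → ℝ}

theorem continuous_integral_uncurry (hf : Continuous (Function.uncurry f)) :
    Continuous (fun z : ℝ × ℝ ↦ ∫ θ in (0 : ℝ)..z.2, f z.1 θ) :=
  intervalIntegral.continuous_parametric_intervalIntegral_of_continuous
    (f := fun (z : ℝ × ℝ) θ ↦ f z.1 θ)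
    (hf.comp ((continuous_fst.comp continuous_fst).prodMk continuous_snd)) continuous_snd

theorem continuous_integral_period (hf : Continuous (Function.uncurry f)) (T : ℝ) :
    Continuous (fun y ↦ ∫ θ in (0 : ℝ)..T, f y θ) :=
  (continuous_integral_uncurry hf).comp (continuous_id.prodMk continuous_const)

theorem continuous_periodicPrimitive (hf : Continuous (Function.uncurry f)) :
    Continuous (fun z : ℝ × ℝ ↦ periodicPrimitive f z.1 z.2) := by
  unfold periodicPrimitive
  have h := (continuous_integral_period hf (2 * Real.pi)).comp (continuous_fst (X := ℝ) (Y := ℝ))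
  exact (continuous_integral_uncurry hf).sub ((continuous_snd.div_const _).mul h)

theorem periodicPrimitive_periodic (hf : Continuous (Function.uncurry f))
    (hper : ∀ y, Function.Periodic (f y) (2 * Real.pi)) (y : ℝ) :
    Function.Periodic (periodicPrimitive f y) (2 * Real.pi) := by
  intro q
  have hc : Continuous (f y) := hf.comp (continuous_const.prodMk continuous_id)
  have h := (hper y).intervalIntegral_add_eq 0 q
  have h2 := intervalIntegral.integral_add_adjacent_intervals (μ := volume)
    (hc.intervalIntegrable 0 q) (hc.intervalIntegrable q (q + 2 * Real.pi))
  unfold periodicPrimitive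
  rw [← h2, ← h, zero_add]
  have := Real.pi_pos
  field_simp
  ring

theorem periodicPrimitive_zero (y : ℝ) : periodicPrimitive f y 0 = 0 := by
  simp [periodicPrimitive]

theorem periodicPrimitive_int_mul (hf : Continuous (Function.uncurry f))
    (hper : ∀ y, Function.Periodic (f y) (2 * Real.pi)) (y : ℝ) (n : ℤ) :
    periodicPrimitive f y (n * (2 * Real.pi)) = 0 := by
  have h := (periodicPrimitive_periodic hf hper y).int_mul n 0
  rwa [zero_add, periodicPrimitive_zero] at h

/-- A continuous function that is periodic in its second argument is bounded while its first
argument stays in a compact interval. -/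
theorem exists_bound_of_periodic {h : ℝ → ℝ → ℝ} (hh : Continuous (Function.uncurry h)) {T : ℝ}
    (hT : 0 < T) (hper : ∀ y, Function.Periodic (h y) T) (a b : ℝ) :
    ∃ K, 0 < K ∧ ∀ y ∈ Icc a b, ∀ q, |h y q| ≤ K := by
  obtain ⟨K, hK⟩ := (isCompact_Icc (a := a) (b := b) |>.prod
    (isCompact_Icc (a := (0 : ℝ)) (b := T))).exists_bound_of_continuousOn hh.continuousOn
  refine ⟨max K 1, by positivity, fun y hy q ↦ ?_⟩
  obtain ⟨s, hs, hqs⟩ := (hper y).exists_mem_Ico₀ hT q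
  rw [hqs]
  exact (hK (y, s) ⟨hy, hs.1, hs.2.le⟩).trans (le_max_left _ _)

theorem hasDerivAt_integral_param {f' : ℝ → ℝ → ℝ} (hf : Continuous (Function.uncurry f))
    (hf' : Continuous (Function.uncurry f')) (hd : ∀ y θ, HasDerivAt (f · θ) (f' y θ) y)
    (y a b : ℝ) :
    HasDerivAt (fun y ↦ ∫ θ in a..b, f y θ) (∫ θ in a..b, f' y θ) y := by
  obtain ⟨K, hK⟩ := (isCompact_closedBall y 1 |>.prod
    (isCompact_uIcc (a := a) (b := b))).exists_bound_of_continuousOn hf'.continuousOn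
  have hc : ∀ y, Continuous (f y) := fun y ↦ hf.comp (continuous_const.prodMk continuous_id)
  have hc' : ∀ y, Continuous (f' y) := fun y ↦ hf'.comp (continuous_const.prodMk continuous_id)
  refine (intervalIntegral.hasDerivAt_integral_of_dominated_loc_of_deriv_le (bound := fun _ ↦ K)
    (Metric.closedBall_mem_nhds y one_pos)
    (Eventually.of_forall fun y ↦ (hc y).aestronglyMeasurable) ((hc y).intervalIntegrable a b)
    (hc' y).aestronglyMeasurable
    (Eventually.of_forall fun θ hθ z hz ↦ hK (z, θ) ⟨hz, uIoc_subset_uIcc hθ⟩)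
    (by simp) (Eventually.of_forall fun θ _ z _ ↦ hd z θ)).2

theorem hasDerivAt_periodicPrimitive_fst {f' : ℝ → ℝ → ℝ}
    (hf : Continuous (Function.uncurry f)) (hf' : Continuous (Function.uncurry f'))
    (hd : ∀ y θ, HasDerivAt (f · θ) (f' y θ) y) (y q : ℝ) :
    HasDerivAt (periodicPrimitive f · q) (periodicPrimitive f' y q) y :=
  (hasDerivAt_integral_param hf hf' hd y 0 q).sub
    ((hasDerivAt_integral_param hf hf' hd y 0 (2 * Real.pi)).const_mul _)

theorem hasDerivAt_periodicPrimitive_snd (hf : Continuous (Function.uncurry f)) (y q : ℝ) :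
    HasDerivAt (periodicPrimitive f y)
      (f y q - (∫ θ in (0 : ℝ)..(2 * Real.pi), f y θ) / (2 * Real.pi)) q := by
  have hc : Continuous (f y) := hf.comp (continuous_const.prodMk continuous_id)
  have h1 := intervalIntegral.integral_hasDerivAt_right (hc.intervalIntegrable 0 q)
    hc.aestronglyMeasurable.stronglyMeasurableAtFilter hc.continuousAt
  have h2 := ((hasDerivAt_id q).div_const (2 * Real.pi)).mul_const
    (∫ θ in (0 : ℝ)..(2 * Real.pi), f y θ)
  refine (h1.sub h2).congr_deriv ?_
  ring

/-- Chain rule for `periodicPrimitive f` along a differentiable curve. -/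
theorem hasDerivAt_periodicPrimitive_comp {f' : ℝ → ℝ → ℝ}
    (hf : Continuous (Function.uncurry f)) (hf' : Continuous (Function.uncurry f'))
    (hd : ∀ y θ, HasDerivAt (f · θ) (f' y θ) y) {y q : ℝ → ℝ} {y' q' t : ℝ}
    (hy : HasDerivAt y y' t) (hq : HasDerivAt q q' t) :
    HasDerivAt (fun t ↦ periodicPrimitive f (y t) (q t))
      (periodicPrimitive f' (y t) (q t) * y' + (f (y t) (q t)
        - (∫ θ in (0 : ℝ)..(2 * Real.pi), f (y t) θ) / (2 * Real.pi)) * q') t := by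
  -- Joint differentiability follows from the existence and joint continuity of both partial
  -- derivatives.
  have h := hasStrictFDerivAt_uncurry_coprod (𝕜 := ℝ) (u := (y t, q t)) (f := periodicPrimitive f)
    (f₁ := fun y q ↦ ContinuousLinearMap.toSpanSingleton ℝ (periodicPrimitive f' y q))
    (f₂ := fun y q ↦ ContinuousLinearMap.toSpanSingleton ℝ
      (f y q - (∫ θ in (0 : ℝ)..(2 * Real.pi), f y θ) / (2 * Real.pi)))
    (Eventually.of_forall fun v ↦
      (hasDerivAt_periodicPrimitive_fst hf hf' hd v.1 v.2).hasFDerivAt)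
    (Eventually.of_forall fun v ↦ (hasDerivAt_periodicPrimitive_snd hf v.1 v.2).hasFDerivAt)
    ?_ ?_
  · have h3 := h.hasFDerivAt.comp_hasDerivAt t (hy.prodMk hq)
    refine h3.congr_deriv ?_
    simp [Function.HasUncurry.uncurry, mul_comm]
  · apply Continuous.continuousAt
    exact (ContinuousLinearMap.toSpanSingletonCLE (𝕜 := ℝ) (E := ℝ)).continuous.comp
      (continuous_periodicPrimitive hf')
  · apply Continuous.continuousAt
    exact (ContinuousLinearMap.toSpanSingletonCLE (𝕜 := ℝ) (E := ℝ)).continuous.comp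
      (hf.sub (((continuous_integral_period hf _).comp continuous_fst).div_const _))

end PeriodicPrimitive

/-! ### Hitting times of scalar functions. -/

theorem exists_first_hit {w : ℝ → ℝ} (hw : Continuous w) {c s : ℝ} (hs : 0 ≤ s) (h0 : c ≤ w 0)
    (hc : w s ≤ c) : ∃ r ∈ Icc 0 s, w r = c ∧ ∀ r' ∈ Icc 0 r, c ≤ w r' := by
  have hcomp : IsCompact (Icc 0 s ∩ {r | w r ≤ c}) :=
    isCompact_Icc.inter_right (isClosed_le hw continuous_const)
  obtain ⟨r, ⟨hr, hwr⟩, hleast⟩ := hcomp.exists_isLeast ⟨s, ⟨hs, le_rfl⟩, hc⟩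
  have hlt : ∀ r' ∈ Icc 0 r, r' ≠ r → c ≤ w r' := by
    intro r' hr' hne
    by_contra! hcon
    exact hne (le_antisymm hr'.2 (hleast ⟨⟨hr'.1, hr'.2.trans hr.2⟩, hcon.le⟩))
  have heq : w r = c := by
    obtain ⟨r', hr', hwr'⟩ := intermediate_value_Icc' hr.1 hw.continuousOn ⟨hwr, h0⟩
    have : r = r' := le_antisymm (hleast ⟨⟨hr'.1, hr'.2.trans hr.2⟩, hwr'.le⟩) hr'.2
    rw [this, hwr']
  refine ⟨r, hr, heq, fun r' hr' ↦ ?_⟩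
  by_cases h : r' = r
  · rw [h, heq]
  · exact hlt r' hr' h

/-- A function whose derivative on `[0, T]` is at least `c` grows there at rate at least `c`. -/
theorem add_mul_le_of_le_deriv {v : ℝ → ℝ} {c T : ℝ}
    (hD : ∀ s ∈ Icc 0 T, ∃ v', HasDerivAt v v' s ∧ c ≤ v') {s t : ℝ} (hs : s ∈ Icc 0 T)
    (ht : t ∈ Icc 0 T) (hst : s ≤ t) : v s + c * (t - s) ≤ v t := by
  have hcont : ContinuousOn v (Icc 0 T) := fun s hs ↦
    (hD s hs).choose_spec.1.continuousAt.continuousWithinAt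
  have := (convex_Icc 0 T).mul_sub_le_image_sub_of_le_deriv hcont
    (fun s hs ↦ (hD s (interior_subset hs)).choose_spec.1.differentiableAt.differentiableWithinAt)
    (C := c) (fun s hs ↦ by
      obtain ⟨v', h1, h2⟩ := hD s (interior_subset hs)
      rwa [h1.deriv]) s hs t ht hst
  linarith

/-- If `v` stays close to `w` and increases at a definite rate as long as `w` stays in the band
`[a', b']`, then `w` reaches `b` without leaving the band. -/
theorem exists_hitting_time {w v : ℝ → ℝ} {a' a b b' η c : ℝ} (hw : Continuous w)
    (h0 : w 0 ∈ Icc a b) (ha : a' ≤ a) (hb : b ≤ b') (hη : 2 * η < a - a') (hc : 0 < c)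
    (hclose : ∀ τ, 0 ≤ τ → (∀ s ∈ Icc 0 τ, w s ∈ Icc a' b') → |v τ - w τ| ≤ η)
    (hderiv : ∀ τ, 0 ≤ τ → (∀ s ∈ Icc 0 τ, w s ∈ Icc a' b') → ∃ v', HasDerivAt v v' τ ∧ c ≤ v') :
    ∃ T, 0 ≤ T ∧ w T = b ∧ ∀ s ∈ Icc 0 T, w s ∈ Icc a' b' := by
  have hgrow : ∀ τ, 0 ≤ τ → (∀ s ∈ Icc 0 τ, w s ∈ Icc a' b') → v 0 + c * τ ≤ v τ := by
    intro τ hτ hband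
    have := add_mul_le_of_le_deriv (c := c) (fun s hs ↦
      hderiv s hs.1 fun r hr ↦ hband r ⟨hr.1, hr.2.trans hs.2⟩) ⟨le_rfl, hτ⟩ ⟨hτ, le_rfl⟩ hτ
    rwa [sub_zero] at this
  have hclose0 := abs_le.1 (hclose 0 le_rfl fun s hs ↦ by
    rw [le_antisymm hs.2 hs.1]
    exact ⟨ha.trans h0.1, h0.2.trans hb⟩)
  -- At a first time with `w = a'` one would have `v ≤ a' + η`, but `v` has not decreased from `v 0
  -- ≥ a - η`; this contradicts `2η < a - a'`.
  have hlow : ∀ τ, 0 ≤ τ → (∀ s ∈ Icc 0 τ, w s ≤ b) → ∀ s ∈ Icc 0 τ, w s ∈ Icc a' b' := by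
    intro τ hτ hle s hs
    refine ⟨?_, (hle s hs).trans hb⟩
    by_contra! hlt
    obtain ⟨r, hr, hwr, hbefore⟩ := exists_first_hit hw hs.1 (ha.trans h0.1) hlt.le
    have hband : ∀ r' ∈ Icc 0 r, w r' ∈ Icc a' b' := fun r' hr' ↦
      ⟨hbefore r' hr', (hle r' ⟨hr'.1, hr'.2.trans (hr.2.trans hs.2)⟩).trans hb⟩
    have h1 := hgrow r hr.1 hband
    have h2 := abs_le.1 (hclose r hr.1 hband)
    have h3 := mul_nonneg hc.le hr.1
    linarith [h0.1]
  by_cases hex : ∃ t, 0 ≤ t ∧ b ≤ w t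
  · obtain ⟨t, ht, hbt⟩ := hex
    obtain ⟨T, hT, hwT, hbefore⟩ := exists_first_hit hw.neg ht (neg_le_neg h0.2) (neg_le_neg hbt)
    exact ⟨T, hT.1, neg_inj.1 hwT, hlow T hT.1 fun s hs ↦ neg_le_neg_iff.1 (hbefore s hs)⟩
  · push Not at hex
    -- By this time growth at rate `c` has pushed `v` above `b + η`, which is impossible while `w <
    -- b`.
    set τ := |b + η - v 0| / c + 1 with hτdef
    have hτ : 0 ≤ τ := by positivity
    have hband := hlow τ hτ fun s hs ↦ (hex s hs.1).le
    have h1 := hgrow τ hτ hband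
    have h2 := abs_le.1 (hclose τ hτ hband)
    have h3 : c * τ = |b + η - v 0| + c := by rw [hτdef]; field_simp
    linarith [hex τ hτ, le_abs_self (b + η - v 0)]

/-! ### First-order expansion of the energy drift. -/

namespace AcrobotParams

variable (P : AcrobotParams)

/-- The squared momentum at `q = 0` on the level set of the energy through `(q, p)`. -/
noncomputable def levelSq (q p : ℝ) : ℝ :=
  p ^ 2 + 30 * P.m ^ 2 * P.g * P.l ^ 3 * (1 - Real.cos q)

/-- The derivative of `levelSq` along the constrained dynamics. -/
noncomputable def levelSqDot (I q p : ℝ) : ℝ :=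
  2 * p * P.pDot I q p + 30 * P.m ^ 2 * P.g * P.l ^ 3 * Real.sin q * P.qDot I q p

/-- The first order coefficient in `I` of `levelSqDot`, up to the factor `2 / (5 m l²)`. -/
noncomputable def gainRate (q p : ℝ) : ℝ :=
  5 * P.C * (18 * (P.m ^ 2 * P.g * P.l ^ 3) * Real.sin q ^ 2 - p ^ 2 * Real.cos q)

theorem hasDerivAt_levelSq {I t : ℝ} {q p : ℝ → ℝ} (hq : HasDerivAt q (P.qDot I (q t) (p t)) t)
    (hp : HasDerivAt p (P.pDot I (q t) (p t)) t) :
    HasDerivAt (fun t ↦ P.levelSq (q t) (p t)) (P.levelSqDot I (q t) (p t)) t := by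
  unfold levelSq levelSqDot
  refine ((hp.fun_pow 2).fun_add ((hq.cos.const_sub 1).const_mul _)).congr_deriv ?_
  push_cast
  ring

/-- Uniform first order expansion of the constrained dynamics as `I → 0`. -/
theorem isLittleO_field (M : ℝ) :
    ((fun z : ℝ × ℝ × ℝ ↦ P.qDot z.1 z.2.1 z.2.2 - z.2.2 / (5 * (P.m * P.l ^ 2)))
        =o[𝓝 0 ×ˢ 𝓟 (univ ×ˢ Icc (-M) M)] fun _ ↦ (1 : ℝ)) ∧
    ((fun z : ℝ × ℝ × ℝ ↦ P.levelSqDot z.1 z.2.1 z.2.2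
          - 2 * z.1 * P.gainRate z.2.1 z.2.2 / (5 * (P.m * P.l ^ 2)))
        =o[𝓝 0 ×ˢ 𝓟 (univ ×ˢ Icc (-M) M)] fun z ↦ z.1) := by
  -- The principal factor makes every estimate uniform over all `q` and `|p| ≤ M`; only `I` tends to
  -- `0`.
  set l : Filter (ℝ × ℝ × ℝ) := 𝓝 0 ×ˢ 𝓟 (univ ×ˢ Icc (-M) M) with hl
  have hm := P.m_pos
  have hlpos := P.l_pos
  have hk : 0 < P.m * P.l ^ 2 := by positivity
  have hε : Tendsto (fun z : ℝ × ℝ × ℝ ↦ z.1) l (𝓝 0) := tendsto_fst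
  have hε1 : (fun z : ℝ × ℝ × ℝ ↦ z.1) =o[l] fun _ ↦ (1 : ℝ) := (isLittleO_one_iff ℝ).2 hε
  have hpb : (fun z : ℝ × ℝ × ℝ ↦ z.2.2) =O[l] fun _ ↦ (1 : ℝ) := by
    refine IsBigO.of_bound M ?_
    rw [hl]
    filter_upwards [tendsto_snd.eventually (eventually_mem_principal _)] with z hz
    simpa [abs_le] using hz.2
  have hbdd : ∀ {f : ℝ × ℝ × ℝ → ℝ} (K : ℝ), (∀ z, |f z| ≤ K) → f =O[l] fun _ ↦ (1 : ℝ) :=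
    fun K h ↦ IsBigO.of_bound K (Eventually.of_forall fun z ↦ by simpa using h z)
  have hsin := hbdd (f := fun z ↦ Real.sin z.2.1) 1 fun z ↦ Real.abs_sin_le_one _
  have hcos := hbdd (f := fun z ↦ Real.cos z.2.1) 1 fun z ↦ Real.abs_cos_le_one _
  have bmul : ∀ {f h e : ℝ × ℝ × ℝ → ℝ}, f =O[l] (fun _ ↦ (1 : ℝ)) → h =o[l] e →
      (fun z ↦ f z * h z) =o[l] e := fun hf hh ↦ by simpa using hf.mul_isLittleO hh
  have bmulO : ∀ {f h e : ℝ × ℝ × ℝ → ℝ}, f =O[l] (fun _ ↦ (1 : ℝ)) → h =O[l] e →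
      (fun z ↦ f z * h z) =O[l] e := fun hf hh ↦ by simpa using hf.mul hh
  have const_big : ∀ c : ℝ, (fun _ : ℝ × ℝ × ℝ ↦ c) =O[l] fun _ ↦ (1 : ℝ) :=
    fun c ↦ hbdd |c| fun _ ↦ le_rfl
  -- expansion of the leg angle
  have hIp : (fun z : ℝ × ℝ × ℝ ↦ z.1 * z.2.2) =O[l] fun z ↦ z.1 := by
    simpa using (isBigO_refl (fun z : ℝ × ℝ × ℝ ↦ z.1) l).mul hpb
  have hIp0 : Tendsto (fun z : ℝ × ℝ × ℝ ↦ z.1 * z.2.2) l (𝓝 0) :=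
    hIp.trans_tendsto hε
  have harctan : (fun z : ℝ × ℝ × ℝ ↦ Real.arctan (z.1 * z.2.2) - z.1 * z.2.2) =o[l]
      fun z ↦ z.1 := by
    have h := (Real.hasDerivAt_arctan 0).isLittleO.comp_tendsto hIp0
    simp only [Function.comp_def, Real.arctan_zero, sub_zero, smul_eq_mul] at h
    norm_num at h
    exact h.trans_isBigO hIp
  set a : ℝ × ℝ × ℝ → ℝ := fun z ↦ P.legAngle z.1 z.2.2 with ha
  have ha1 : (fun z ↦ a z - P.qbar * (z.1 * z.2.2)) =o[l] fun z ↦ z.1 := by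
    have := harctan.const_mul_left P.qbar
    refine this.congr_left fun z ↦ ?_
    simp only [ha, legAngle]
    ring
  have haO : a =O[l] fun z ↦ z.1 := by
    have := ha1.isBigO.add (hIp.const_mul_left P.qbar)
    refine this.congr_left fun z ↦ ?_
    ring
  have ha0 : Tendsto a l (𝓝 0) := haO.trans_tendsto hε
  have hsina : (fun z ↦ Real.sin (a z) - a z) =o[l] fun z ↦ z.1 := by
    have h := (Real.hasDerivAt_sin 0).isLittleO.comp_tendsto ha0
    simp only [Function.comp_def, Real.sin_zero, Real.cos_zero, sub_zero, smul_eq_mul,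
      mul_one] at h
    exact h.trans_isBigO haO
  have hcosa : (fun z ↦ Real.cos (a z) - 1) =o[l] fun z ↦ z.1 := by
    have h := (Real.hasDerivAt_cos 0).isLittleO.comp_tendsto ha0
    simp only [Function.comp_def, Real.sin_zero, Real.cos_zero, sub_zero, smul_eq_mul,
      neg_zero, mul_zero] at h
    exact h.trans_isBigO haO
  -- expansion of the gravity term
  set s : ℝ × ℝ × ℝ → ℝ := fun z ↦ 2 * Real.sin z.2.1 + Real.sin (z.2.1 + a z) with hs
  have hsb : s =O[l] fun _ ↦ (1 : ℝ) := by
    exact hbdd 3 fun z ↦ abs_two_sin_add_sin_le _ _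
  have hs1 : (fun z ↦ s z - (3 * Real.sin z.2.1 + Real.cos z.2.1 * (P.qbar * (z.1 * z.2.2))))
      =o[l] fun z ↦ z.1 := by
    refine ((bmul hsin hcosa).add ((bmul hcos hsina).add (bmul hcos ha1))).congr_left
      fun z ↦ ?_
    simp only [hs, Real.sin_add]
    ring
  have hs0 : (fun z ↦ s z - 3 * Real.sin z.2.1) =o[l] fun _ ↦ (1 : ℝ) := by
    have h1 : (fun z : ℝ × ℝ × ℝ ↦ Real.cos z.2.1 * (P.qbar * (z.1 * z.2.2))) =o[l]
        fun _ ↦ (1 : ℝ) :=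
      bmul hcos ((hIp.trans_isLittleO hε1).const_mul_left P.qbar)
    refine ((hs1.trans hε1).add h1).congr_left fun z ↦ ?_
    ring
  -- expansion of the inverse inertia
  set D : ℝ × ℝ × ℝ → ℝ := fun z ↦ 3 + 2 * Real.cos (a z) with hD
  have hD1 : ∀ z, 1 ≤ D z := fun z ↦ by
    simp only [hD]; linarith [Real.neg_one_le_cos (a z)]
  have hu1 : ∀ z : ℝ × ℝ × ℝ, 1 ≤ 1 + z.1 ^ 2 * z.2.2 ^ 2 := fun z ↦ by
    nlinarith [sq_nonneg (z.1 * z.2.2)]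
  have hDinv : (fun z ↦ (D z)⁻¹) =O[l] fun _ ↦ (1 : ℝ) := hbdd 1 fun z ↦ by
    rw [abs_of_pos (inv_pos.2 (by linarith [hD1 z]))]
    exact inv_le_one_of_one_le₀ (hD1 z)
  have huinv : (fun z : ℝ × ℝ × ℝ ↦ (1 + z.1 ^ 2 * z.2.2 ^ 2)⁻¹) =O[l] fun _ ↦ (1 : ℝ) :=
    hbdd 1 fun z ↦ by
      rw [abs_of_pos (inv_pos.2 (by linarith [hu1 z]))]
      exact inv_le_one_of_one_le₀ (hu1 z)
  have hD5 : (fun z ↦ (D z)⁻¹ - 1 / 5) =o[l] fun z ↦ z.1 := by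
    refine (bmul hDinv (hcosa.const_mul_left (-2 / 5))).congr_left fun z ↦ ?_
    have := hD1 z
    have h0 : D z ≠ 0 := by linarith
    have e : Real.cos (a z) = (D z - 3) / 2 := by simp only [hD]; ring
    rw [e]
    field_simp
    ring
  have hu : (fun z : ℝ × ℝ × ℝ ↦ (1 + z.1 ^ 2 * z.2.2 ^ 2)⁻¹ - 1) =o[l] fun _ ↦ (1 : ℝ) := by
    have h1 : (fun z : ℝ × ℝ × ℝ ↦ (z.1 * z.2.2) * (z.1 * z.2.2)) =o[l] fun _ ↦ (1 : ℝ) :=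
      bmul ((hIp.trans_isLittleO hε1).isBigO) (hIp.trans_isLittleO hε1)
    refine (bmul huinv h1.neg_left).congr_left fun z ↦ ?_
    have h0 : 1 + z.1 ^ 2 * z.2.2 ^ 2 ≠ 0 := by linarith [hu1 z]
    field_simp
    ring
  set N : ℝ × ℝ × ℝ → ℝ := fun z ↦ (1 + Real.cos (a z)) * (D z)⁻¹ *
    (1 + z.1 ^ 2 * z.2.2 ^ 2)⁻¹ with hN
  have hN0 : (fun z ↦ N z - 2 / 5) =o[l] fun _ ↦ (1 : ℝ) := by
    have hcb := hbdd (f := fun z ↦ 1 + Real.cos (a z)) 2 fun z ↦ by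
      rw [abs_le]
      constructor <;> linarith [Real.neg_one_le_cos (a z), Real.cos_le_one (a z)]
    have h1 := bmul (bmulO hcb hDinv) hu
    have h2 := bmul hcb (hD5.trans hε1)
    have h3 := (hcosa.trans hε1).const_mul_left (1 / 5)
    refine (h1.add (h2.add h3)).congr_left fun z ↦ ?_
    simp only [hN]
    ring
  -- expansion of `qDot`
  have hqDot : ∀ z : ℝ × ℝ × ℝ, P.qDot z.1 z.2.1 z.2.2 =
      (z.2.2 * (D z)⁻¹ + P.C * (z.1 * (s z * N z))) / (P.m * P.l ^ 2) := by
    intro z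
    have h1 : 1 + z.1 ^ 2 * z.2.2 ^ 2 ≠ 0 := by linarith [hu1 z]
    have h2 : 3 + 2 * Real.cos (P.legAngle z.1 z.2.2) ≠ 0 := by
      have := hD1 z; simp only [hD, ha] at this; linarith
    simp only [qDot, hN, hs, hD, ha, C]
    field_simp
  -- The coefficient `6/5` is the product of the limits `s → 3 sin q` and `N → 2/5`.
  have hq1 : (fun z : ℝ × ℝ × ℝ ↦ P.qDot z.1 z.2.1 z.2.2 -
      (z.2.2 / 5 + 6 / 5 * P.C * (z.1 * Real.sin z.2.1)) / (P.m * P.l ^ 2)) =o[l]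
      fun z ↦ z.1 := by
    have h1 := (bmul hsb hN0).add (hs0.const_mul_left (2 / 5))
    have h2 := ((isBigO_refl (fun z : ℝ × ℝ × ℝ ↦ z.1) l).mul_isLittleO h1).const_mul_left P.C
    simp only [mul_one] at h2
    have h3 := ((bmul hpb hD5).add h2).const_mul_left (P.m * P.l ^ 2)⁻¹
    refine h3.congr_left fun z ↦ ?_
    rw [hqDot]
    field_simp
    ring
  constructor
  · have h1 := (bmul hsin hε1).const_mul_left (6 / 5 * P.C / (P.m * P.l ^ 2))
    refine ((hq1.trans hε1).add h1).congr_left fun z ↦ ?_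
    field_simp
    ring
  -- The zeroth-order terms `∓ 6 m g l p sin q` cancel by conservation of energy at `I = 0`, leaving
  -- the term linear in `I`.
  · have h1 := (bmul hpb hs1).const_mul_left (-2 * (P.m * P.g * P.l))
    have h2 := (bmul hsin hq1).const_mul_left (30 * P.m ^ 2 * P.g * P.l ^ 3)
    refine (h1.add h2).congr_left fun z ↦ ?_
    have hp : P.pDot z.1 z.2.1 z.2.2 = -(P.m * P.g * P.l * s z) := rfl
    simp only [levelSqDot, gainRate, hp, C]
    field_simp
    ring

theorem exists_field_bounds (M : ℝ) {η : ℝ} (hη : 0 < η) :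
    ∃ δ, 0 < δ ∧ ∀ I, |I| < δ → ∀ q p, |p| ≤ M →
      |P.qDot I q p - p / (5 * (P.m * P.l ^ 2))| ≤ η ∧
      |P.levelSqDot I q p - 2 * I * P.gainRate q p / (5 * (P.m * P.l ^ 2))| ≤ η * |I| := by
  obtain ⟨h1, h2⟩ := P.isLittleO_field M
  have h := (h1.bound hη).and (h2.bound hη)
  rw [eventually_prod_principal_iff] at h
  obtain ⟨δ, hδ, hball⟩ := Metric.eventually_nhds_iff.1 h
  refine ⟨δ, hδ, fun I hI q p hp ↦ ?_⟩
  have := hball (by simpa using hI) (q, p) ⟨mem_univ _, abs_le.1 hp⟩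
  simpa using this

end AcrobotParams

/-! ### Gain per unit angle, in the logarithmic level coordinate `y = log (w - criticalSq)`, which
makes it smooth for every real `y`. -/

namespace AcrobotParams

variable (P : AcrobotParams)

/-- The squared momentum at angle `θ` on the rotation level whose minimal squared momentum is
`exp y`. -/
noncomputable def momentumSq (y θ : ℝ) : ℝ :=
  30 * P.m ^ 2 * P.g * P.l ^ 3 * (1 + Real.cos θ) + Real.exp y

theorem momentumSq_pos (y θ : ℝ) : 0 < P.momentumSq y θ := by
  have hm := P.m_pos
  have hl := P.l_pos
  have hg := P.g_pos
  have : 0 ≤ 1 + Real.cos θ := by linarith [Real.neg_one_le_cos θ]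
  unfold momentumSq
  positivity

/-- First order energy gain per unit angle along the rotation level parametrized by `y`. -/
noncomputable def angularGain (y θ : ℝ) : ℝ :=
  P.gainRate θ √(P.momentumSq y θ) / √(P.momentumSq y θ)

/-- The derivative of `angularGain` in its first argument. -/
noncomputable def angularGainDeriv (y θ : ℝ) : ℝ :=
  5 * P.C * (18 * (P.m ^ 2 * P.g * P.l ^ 3) * Real.sin θ ^ 2 *
      (-(Real.exp y / (2 * √(P.momentumSq y θ))) / √(P.momentumSq y θ) ^ 2)
    - Real.exp y / (2 * √(P.momentumSq y θ)) * Real.cos θ)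

theorem angularGain_eq (y θ : ℝ) : P.angularGain y θ =
    5 * P.C * (18 * (P.m ^ 2 * P.g * P.l ^ 3) * Real.sin θ ^ 2 * (√(P.momentumSq y θ))⁻¹
      - √(P.momentumSq y θ) * Real.cos θ) := by
  have h := (Real.sqrt_pos.2 (P.momentumSq_pos y θ)).ne'
  unfold angularGain gainRate
  field_simp

theorem continuous_momentumSq : Continuous (fun z : ℝ × ℝ ↦ P.momentumSq z.1 z.2) := by
  unfold momentumSq
  fun_prop

theorem continuous_angularGain : Continuous (Function.uncurry P.angularGain) := by
  have h := P.continuous_momentumSq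
  have h0 : ∀ z : ℝ × ℝ, √(P.momentumSq z.1 z.2) ≠ 0 :=
    fun z ↦ (Real.sqrt_pos.2 (P.momentumSq_pos z.1 z.2)).ne'
  simp only [Function.uncurry_def, angularGain, gainRate]
  refine Continuous.div ?_ (by fun_prop) h0
  fun_prop

theorem continuous_angularGainDeriv : Continuous (Function.uncurry P.angularGainDeriv) := by
  have h := P.continuous_momentumSq
  have h0 : ∀ z : ℝ × ℝ, √(P.momentumSq z.1 z.2) ≠ 0 :=
    fun z ↦ (Real.sqrt_pos.2 (P.momentumSq_pos z.1 z.2)).ne'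
  have h1 : Continuous fun z : ℝ × ℝ ↦ Real.exp z.1 / (2 * √(P.momentumSq z.1 z.2)) :=
    Continuous.div (by fun_prop) (by fun_prop) fun z ↦ mul_ne_zero two_ne_zero (h0 z)
  have h2 : Continuous fun z : ℝ × ℝ ↦
      -(Real.exp z.1 / (2 * √(P.momentumSq z.1 z.2))) / √(P.momentumSq z.1 z.2) ^ 2 :=
    Continuous.div h1.neg (by fun_prop) fun z ↦ pow_ne_zero _ (h0 z)
  simp only [Function.uncurry_def, angularGainDeriv]
  fun_prop

theorem hasDerivAt_angularGain (y θ : ℝ) :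
    HasDerivAt (P.angularGain · θ) (P.angularGainDeriv y θ) y := by
  have h0 := P.momentumSq_pos y θ
  have h1 : HasDerivAt (P.momentumSq · θ) (Real.exp y) y := (Real.hasDerivAt_exp y).const_add _
  have h2 := h1.sqrt h0.ne'
  have h3 := h2.fun_inv (Real.sqrt_pos.2 h0).ne'
  simp only [angularGain_eq]
  exact ((h3.const_mul _).fun_sub (h2.mul_const _)).const_mul _

theorem angularGain_periodic (y : ℝ) : Function.Periodic (P.angularGain y) (2 * Real.pi) := by
  intro θ
  simp [angularGain, momentumSq, gainRate]

theorem angularGainDeriv_periodic (y : ℝ) :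
    Function.Periodic (P.angularGainDeriv y) (2 * Real.pi) := by
  intro θ
  simp [angularGainDeriv, momentumSq]

/-- The total first order gain over one rotation starting with squared momentum `w`. -/
theorem integral_angularGain {w : ℝ} (hw : 60 * P.m ^ 2 * P.g * P.l ^ 3 < w) :
    ∫ θ in (0 : ℝ)..(2 * Real.pi),
      P.angularGain (Real.log (w - 60 * P.m ^ 2 * P.g * P.l ^ 3)) θ = √w * P.S √w := by
  have hm := P.m_pos
  have hl := P.l_pos
  have hg := P.g_pos
  have hq := P.qbar_pos
  have hw0 : 0 < w := lt_trans (by positivity) hw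
  have hs : 0 < √w := Real.sqrt_pos.2 hw0
  unfold S
  rw [← intervalIntegral.integral_const_mul]
  congr 1
  funext θ
  -- The radicand in `b` at `r = √w` is the squared momentum on the level `w`; the factor `√w` in
  -- the result cancels `|r|` in the denominator of `b`.
  have hρ : √w ^ 2 - 30 * P.m ^ 2 * P.g * P.l ^ 3 * (1 - Real.cos θ) =
      P.momentumSq (Real.log (w - 60 * P.m ^ 2 * P.g * P.l ^ 3)) θ := by
    unfold momentumSq
    rw [Real.exp_log (by linarith), Real.sq_sqrt hw0.le]
    ring
  have hpos := P.momentumSq_pos (Real.log (w - 60 * P.m ^ 2 * P.g * P.l ^ 3)) θ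
  unfold b angularGain
  rw [hρ, abs_of_pos hs]
  unfold gainRate
  rw [Real.sq_sqrt hpos.le, ← hρ]
  have hne : √(√w ^ 2 - 30 * P.m ^ 2 * P.g * P.l ^ 3 * (1 - Real.cos θ)) ≠ 0 := by
    rw [hρ]; exact (Real.sqrt_pos.2 hpos).ne'
  rw [Real.sq_sqrt hw0.le] at hne ⊢
  unfold C
  field_simp
  ring

end AcrobotParams

/-! ### Auxiliary compactness, sign and remainder estimates. -/

/-- A continuous function that is positive on `[a, b]` is bounded below by a positive constant on
a larger interval contained in a given ray. -/
theorem exists_Icc_enlargement {f : ℝ → ℝ} {r a b : ℝ} (hf : ContinuousOn f (Ioi r))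
    (hra : r < a) (hab : a ≤ b) (hpos : ∀ x ∈ Icc a b, 0 < f x) :
    ∃ a' b' c, r < a' ∧ a' < a ∧ b < b' ∧ 0 < c ∧ ∀ x ∈ Icc a' b', c ≤ f x := by
  have hopen : IsOpen (Ioi r ∩ f ⁻¹' Ioi 0) := hf.isOpen_inter_preimage isOpen_Ioi isOpen_Ioi
  obtain ⟨δ, hδ, hsub⟩ := (isCompact_Icc (a := a) (b := b)).exists_cthickening_subset_open hopen
    fun x hx ↦ ⟨hra.trans_le hx.1, hpos x hx⟩
  have hmem : Icc (a - δ) (b + δ) ⊆ Ioi r ∩ f ⁻¹' Ioi 0 := by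
    refine Subset.trans (fun x hx ↦ ?_) hsub
    refine Metric.mem_cthickening_of_dist_le x (max a (min x b)) δ _
      ⟨le_max_left _ _, max_le hab (min_le_right _ _)⟩ ?_
    rw [Real.dist_eq, abs_le]
    obtain ⟨h1, h2⟩ := hx
    grind
  obtain ⟨x₀, hx₀, hmin⟩ := (isCompact_Icc (a := a - δ) (b := b + δ)).exists_isMinOn
    ⟨a, by constructor <;> linarith⟩ (hf.mono fun x hx ↦ (hmem hx).1)
  exact ⟨a - δ, b + δ, f x₀, (hmem ⟨le_rfl, by linarith⟩).1, by linarith, by linarith,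
    (hmem hx₀).2, fun x hx ↦ hmin hx⟩

theorem pos_of_forall_ne_zero {p : ℝ → ℝ} (hp : Continuous p) (h0 : 0 < p 0) {τ : ℝ}
    (hτ : 0 ≤ τ) (hne : ∀ s ∈ Icc 0 τ, p s ≠ 0) : 0 < p τ := by
  by_contra! hle
  obtain ⟨s, hs, hps⟩ := intermediate_value_Icc' hτ hp.continuousOn ⟨hle, h0.le⟩
  exact hne s hs hps

theorem finite_setOf_cos_eq_one {q : ℝ → ℝ} {T : ℝ} (hq : StrictMonoOn q (Icc 0 T)) :
    {t | t ∈ Icc 0 T ∧ Real.cos (q t) = 1}.Finite := by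
  by_cases hT : 0 ≤ T
  · have hfin : ((fun n : ℤ ↦ (n : ℝ) * (2 * Real.pi)) ''
        Icc ⌊q 0 / (2 * Real.pi)⌋ ⌈q T / (2 * Real.pi)⌉).Finite := (finite_Icc _ _).image _
    refine Finite.of_injOn (f := q) ?_ (hq.injOn.mono fun t ht ↦ ht.1) hfin
    rintro t ⟨ht, hcos⟩
    obtain ⟨n, hn⟩ := (Real.cos_eq_one_iff _).1 hcos
    have hpi := Real.two_pi_pos
    refine ⟨n, ⟨?_, ?_⟩, hn⟩
    · have h1 : q 0 ≤ q t := hq.monotoneOn ⟨le_rfl, hT⟩ ht ht.1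
      exact_mod_cast (Int.floor_le _).trans ((div_le_iff₀ hpi).2 (hn ▸ h1))
    · have h1 : q t ≤ q T := hq.monotoneOn ht ⟨hT, le_rfl⟩ ht.2
      exact_mod_cast ((le_div_iff₀ hpi).2 (hn ▸ h1)).trans (Int.le_ceil _)
  · refine Set.finite_empty.subset fun t ht ↦ ?_
    exact hT (ht.1.1.trans ht.1.2)

/-- The averaged drift dominates the remainders. -/
theorem drift_lower_bound {I p G m Ψ w D Q k κ η L K₂ K₃ d : ℝ} (hd : 0 < d) (hw : d ≤ w)
    (hD : |D - 2 * I * (p * G) / k| ≤ η * |I|) (hQ : |Q - p / k| ≤ η) (hG : |G - m| ≤ K₃)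
    (hΨ : |Ψ| ≤ K₂) (hDL : |D| ≤ L * |I|) (hI : |I| * (2 * (K₂ * L / d)) ≤ κ / 2)
    (hη : η * (1 + 2 * K₃) ≤ κ / 2) (hκ : κ ≤ m * p / k) :
    κ * I ^ 2 ≤ I * (D - 2 * I * (Ψ * (D / w) + (G - m) * Q)) := by
  obtain ⟨e₁, rfl⟩ : ∃ e₁, D = 2 * I * (p * G) / k + e₁ :=
    ⟨D - 2 * I * (p * G) / k, by ring⟩
  obtain ⟨e₂, rfl⟩ : ∃ e₂, Q = p / k + e₂ := ⟨Q - p / k, by ring⟩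
  rw [add_sub_cancel_left] at hD hQ
  have hK₂ : 0 ≤ K₂ := (abs_nonneg _).trans hΨ
  have hK₃ : 0 ≤ K₃ := (abs_nonneg _).trans hG
  set X := (2 * I * (p * G) / k + e₁) / w with hX
  have hI0 := sq_nonneg I
  have t₁ : -(η * I ^ 2) ≤ I * e₁ := by
    have h1 : |I * e₁| ≤ |I| * (η * |I|) := by rw [abs_mul]; gcongr
    have h2 : |I| * (η * |I|) = η * I ^ 2 := by rw [← sq_abs I]; ring
    exact (abs_le.1 (h1.trans_eq h2)).1
  have t₂ : Ψ * X ≤ κ / 4 := by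
    have h1 : |Ψ * X| ≤ K₂ * (L * |I| / d) := by
      rw [abs_mul, hX, abs_div, abs_of_pos (hd.trans_le hw)]
      have h0 : 0 ≤ L * |I| := (abs_nonneg _).trans hDL
      have h1 : 0 < w := hd.trans_le hw
      gcongr
    have h2 : K₂ * (L * |I| / d) = |I| * (2 * (K₂ * L / d)) / 2 := by ring
    linarith [le_abs_self (Ψ * X)]
  have t₃ : (G - m) * e₂ ≤ K₃ * η := by
    refine (le_abs_self _).trans ?_
    rw [abs_mul]
    gcongr
  -- The oscillating `p G / k` cancels between the drift and the correction, so that only the mean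
  -- `m p / k` survives at order `I²`.
  have key : I * (2 * I * (p * G) / k + e₁ - 2 * I * (Ψ * X + (G - m) * (p / k + e₂))) =
      I * e₁ - 2 * (I ^ 2 * (Ψ * X)) + 2 * (I ^ 2 * (m * p / k))
        - 2 * (I ^ 2 * ((G - m) * e₂)) := by
    clear_value X
    ring
  rw [key]
  have u₂ := mul_le_mul_of_nonneg_left t₂ hI0
  have u₃ := mul_le_mul_of_nonneg_left t₃ hI0
  have u₄ := mul_le_mul_of_nonneg_left hκ hI0
  have u₅ := mul_le_mul_of_nonneg_left hη hI0
  linarith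

/-! ### The corrected level and its monotone drift. -/

namespace AcrobotParams

variable (P : AcrobotParams)

/-- The squared momentum at `q = 0` on the critical energy level. -/
noncomputable def criticalSq : ℝ :=
  60 * P.m ^ 2 * P.g * P.l ^ 3

/-- `levelSq` corrected by its first order periodic oscillation. -/
noncomputable def correctedLevelSq (I q p : ℝ) : ℝ :=
  P.levelSq q p - 2 * I * periodicPrimitive P.angularGain
    (Real.log (P.levelSq q p - P.criticalSq)) q

theorem correctedLevelSq_of_cos_eq_one {I q p : ℝ} (hq : Real.cos q = 1) :
    P.correctedLevelSq I q p = P.levelSq q p := by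
  obtain ⟨n, rfl⟩ := (Real.cos_eq_one_iff q).1 hq
  rw [correctedLevelSq, periodicPrimitive_int_mul P.continuous_angularGain P.angularGain_periodic]
  ring

/-- On a level set `p²` is least at `q = π`. Hence momentum cannot vanish, nor change sign, above
the critical level. -/
theorem levelSq_sub_criticalSq_le_sq (q p : ℝ) : P.levelSq q p - P.criticalSq ≤ p ^ 2 := by
  have hm := P.m_pos
  have hl := P.l_pos
  have hg := P.g_pos
  have h0 : 0 ≤ 30 * P.m ^ 2 * P.g * P.l ^ 3 * (1 + Real.cos q) :=
    mul_nonneg (by positivity) (by linarith [Real.neg_one_le_cos q])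
  unfold levelSq criticalSq
  linarith

theorem sq_le_levelSq (q p : ℝ) : p ^ 2 ≤ P.levelSq q p := by
  have hm := P.m_pos
  have hl := P.l_pos
  have hg := P.g_pos
  have h0 : 0 ≤ 30 * P.m ^ 2 * P.g * P.l ^ 3 * (1 - Real.cos q) :=
    mul_nonneg (by positivity) (by linarith [Real.cos_le_one q])
  unfold levelSq
  linarith

/-- On the level through `(q, p)` the momentum at angle `q` is `p` itself. The factor `p` is, up to
`5 m l²`, the unperturbed angular speed, which turns a rate in time into a rate in angle. -/
theorem gainRate_eq_mul_angularGain {q p : ℝ} (hp : 0 < p)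
    (hW : P.criticalSq < P.levelSq q p) :
    P.gainRate q p = p * P.angularGain (Real.log (P.levelSq q p - P.criticalSq)) q := by
  have h : √(P.momentumSq (Real.log (P.levelSq q p - P.criticalSq)) q) = p := by
    rw [momentumSq, Real.exp_log (by linarith), ← Real.sqrt_sq hp.le]
    congr 1
    rw [Real.sqrt_sq hp.le]
    unfold levelSq criticalSq
    ring
  rw [angularGain, h]
  field_simp

theorem hasDerivAt_correctedLevelSq {I t : ℝ} {q p : ℝ → ℝ}
    (hq : HasDerivAt q (P.qDot I (q t) (p t)) t) (hp : HasDerivAt p (P.pDot I (q t) (p t)) t)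
    (hW : P.criticalSq < P.levelSq (q t) (p t)) :
    HasDerivAt (fun t ↦ P.correctedLevelSq I (q t) (p t))
      (P.levelSqDot I (q t) (p t) - 2 * I *
        (periodicPrimitive P.angularGainDeriv
            (Real.log (P.levelSq (q t) (p t) - P.criticalSq)) (q t) *
          (P.levelSqDot I (q t) (p t) / (P.levelSq (q t) (p t) - P.criticalSq)) +
        (P.angularGain (Real.log (P.levelSq (q t) (p t) - P.criticalSq)) (q t) -
          (∫ θ in (0 : ℝ)..(2 * Real.pi),
            P.angularGain (Real.log (P.levelSq (q t) (p t) - P.criticalSq)) θ) / (2 * Real.pi)) *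
          P.qDot I (q t) (p t))) t := by
  have hW' := P.hasDerivAt_levelSq hq hp
  have hy := (hW'.sub_const P.criticalSq).log (by linarith)
  exact hW'.fun_sub ((hasDerivAt_periodicPrimitive_comp P.continuous_angularGain
    P.continuous_angularGainDeriv P.hasDerivAt_angularGain hy hq).const_mul (2 * I))

/-- On a band of rotation levels where the mean gain is bounded below, for small `I` the
corrected level is close to the level and moves in the direction of the sign of `I`, while the
angle increases. -/
theorem exists_drift_bounds {a b c : ℝ} (ha : P.criticalSq < a) (hab : a < b) (hc : 0 < c)
    (hmean : ∀ w ∈ Icc a b,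
      c ≤ ∫ θ in (0 : ℝ)..(2 * Real.pi), P.angularGain (Real.log (w - P.criticalSq)) θ) :
    ∃ δ κ K, 0 < δ ∧ 0 < κ ∧ 0 < K ∧ ∀ I, |I| < δ → ∀ (q p : ℝ → ℝ) (t : ℝ),
      HasDerivAt q (P.qDot I (q t) (p t)) t → HasDerivAt p (P.pDot I (q t) (p t)) t →
      0 < p t → P.levelSq (q t) (p t) ∈ Icc a b →
      (∃ v', HasDerivAt (fun t ↦ P.correctedLevelSq I (q t) (p t)) v' t ∧ κ * I ^ 2 ≤ I * v') ∧
      |P.correctedLevelSq I (q t) (p t) - P.levelSq (q t) (p t)| ≤ K * |I| ∧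
      0 < P.qDot I (q t) (p t) := by
  have hm := P.m_pos
  have hl := P.l_pos
  have hg := P.g_pos
  have hk : 0 < 5 * (P.m * P.l ^ 2) := by positivity
  set k := 5 * (P.m * P.l ^ 2) with hkdef
  set A := P.criticalSq with hA
  have hA0 : 0 < A := by rw [hA, criticalSq]; positivity
  have hG := P.continuous_angularGain
  have hGper := P.angularGain_periodic
  have hG' := P.continuous_angularGainDeriv
  have hpi := Real.two_pi_pos
  obtain ⟨K₁, hK₁, hB₁⟩ := exists_bound_of_periodic (h := periodicPrimitive P.angularGain)
    (continuous_periodicPrimitive hG) hpi (periodicPrimitive_periodic hG hGper)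
    (Real.log (a - A)) (Real.log (b - A))
  obtain ⟨K₂, hK₂, hB₂⟩ := exists_bound_of_periodic (h := periodicPrimitive P.angularGainDeriv)
    (continuous_periodicPrimitive hG') hpi
    (periodicPrimitive_periodic hG' P.angularGainDeriv_periodic)
    (Real.log (a - A)) (Real.log (b - A))
  obtain ⟨K₃, hK₃, hB₃⟩ := exists_bound_of_periodic (h := fun y q ↦ P.angularGain y q -
      (∫ θ in (0 : ℝ)..(2 * Real.pi), P.angularGain y θ) / (2 * Real.pi))
    (hG.sub (((continuous_integral_period hG _).comp continuous_fst).div_const _)) hpi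
    (fun y q ↦ by simp only [hGper y q]) (Real.log (a - A)) (Real.log (b - A))
  obtain ⟨K₄, hK₄, hB₄⟩ := exists_bound_of_periodic hG hpi hGper
    (Real.log (a - A)) (Real.log (b - A))
  -- In the band `a - A ≤ W - A ≤ p² ≤ W ≤ b`, so `pmin` and `M` confine the positive momentum.
  set pmin := √(a - A) with hpmin
  have hpmin0 : 0 < pmin := Real.sqrt_pos.2 (by linarith)
  set M := √b with hM
  have hM0 : 0 < M := Real.sqrt_pos.2 (by linarith)
  set κ := c / (2 * Real.pi) * pmin / k with hκ
  have hκ0 : 0 < κ := by positivity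
  -- The three thresholds serve in turn for the bound `|D| ≤ L |I|`, the positivity of `qDot`, and
  -- the absorption of the remainders into half of `κ`.
  set η := min 1 (min (pmin / (2 * k)) (κ / (2 * (1 + 2 * K₃)))) with hη
  have hη0 : 0 < η := by positivity
  have hη1 : η ≤ 1 := min_le_left _ _
  have hη2 : η ≤ pmin / (2 * k) := (min_le_right _ _).trans (min_le_left _ _)
  have hη3 : η * (1 + 2 * K₃) ≤ κ / 2 := by
    have : η ≤ κ / (2 * (1 + 2 * K₃)) := (min_le_right _ _).trans (min_le_right _ _)
    rw [le_div_iff₀ (by positivity)] at this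
    linarith
  set L := 2 * (M * K₄) / k + 1 with hL
  have hL0 : 0 < L := by positivity
  obtain ⟨δ₀, hδ₀, hfield⟩ := P.exists_field_bounds M hη0
  set δ := min δ₀ (κ / (2 * (2 * (K₂ * L / (a - A))))) with hδ
  have haA : 0 < a - A := by linarith
  have hδ0 : 0 < δ := by positivity
  refine ⟨δ, κ, 2 * K₁, hδ0, hκ0, by positivity, ?_⟩
  intro I hI q p t hq hp hpt hband
  have hWA : A < P.levelSq (q t) (p t) := ha.trans_le hband.1
  have hderiv := P.hasDerivAt_correctedLevelSq hq hp hWA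
  have hgain := P.gainRate_eq_mul_angularGain hpt hWA
  have hlow := P.levelSq_sub_criticalSq_le_sq (q t) (p t)
  have hup := P.sq_le_levelSq (q t) (p t)
  have hcor : P.correctedLevelSq I (q t) (p t) = P.levelSq (q t) (p t) - 2 * I *
    periodicPrimitive P.angularGain (Real.log (P.levelSq (q t) (p t) - A)) (q t) := rfl
  have hmean' := hmean _ hband
  set W := P.levelSq (q t) (p t) with hW
  rw [← hA] at hderiv hgain hlow
  have hy : Real.log (W - A) ∈ Icc (Real.log (a - A)) (Real.log (b - A)) :=
    ⟨Real.log_le_log (by linarith) (by linarith [hband.1]),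
      Real.log_le_log (by linarith) (by linarith [hband.2])⟩
  have b₁ := hB₁ _ hy (q t)
  have b₂ := hB₂ _ hy (q t)
  have b₃ := hB₃ _ hy (q t)
  have b₄ := hB₄ _ hy (q t)
  have hp1 : pmin ≤ p t := Real.sqrt_le_iff.2 ⟨hpt.le, by linarith [hband.1]⟩
  have hp2 : |p t| ≤ M := by
    rw [abs_of_pos hpt]
    exact Real.le_sqrt_of_sq_le (by linarith [hband.2])
  obtain ⟨f₁, f₂⟩ := hfield I (hI.trans_le (min_le_left _ _)) (q t) (p t) hp2
  have hI2 : |I| * (2 * (K₂ * L / (a - A))) ≤ κ / 2 := by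
    have := hI.le.trans (min_le_right _ _)
    rw [le_div_iff₀ (by positivity)] at this
    linarith
  rw [hgain] at f₂
  set G := P.angularGain (Real.log (W - A)) (q t) with hGdef
  set J := ∫ θ in (0 : ℝ)..(2 * Real.pi), P.angularGain (Real.log (W - A)) θ with hJ
  set Ψ := periodicPrimitive P.angularGainDeriv (Real.log (W - A)) (q t) with hΨ
  set Q := P.qDot I (q t) (p t) with hQ
  set D := P.levelSqDot I (q t) (p t) with hD
  refine ⟨⟨_, hderiv, ?_⟩, ?_, ?_⟩
  · have hDL : |D| ≤ L * |I| := by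
      have h1 : |2 * I * (p t * G) / k| ≤ 2 * |I| * (M * K₄) / k := by
        rw [abs_div, abs_of_pos hk, abs_mul, abs_mul, abs_mul, abs_two]
        gcongr
      have h2 : |D - 2 * I * (p t * G) / k| ≤ 1 * |I| := f₂.trans (by gcongr)
      calc |D| = |2 * I * (p t * G) / k + (D - 2 * I * (p t * G) / k)| := by
            rw [add_sub_cancel]
        _ ≤ |2 * I * (p t * G) / k| + |D - 2 * I * (p t * G) / k| := abs_add_le _ _
        _ ≤ 2 * |I| * (M * K₄) / k + 1 * |I| := add_le_add h1 h2
        _ = L * |I| := by rw [hL]; ring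
    have hκJ : κ ≤ J / (2 * Real.pi) * p t / k := by
      have hJ0 : 0 ≤ J := hc.le.trans hmean'
      rw [hκ]
      gcongr
    exact drift_lower_bound haA (sub_le_sub_right hband.1 A) f₂ f₁ b₃ b₂ hDL hI2 hη3 hκJ
  · rw [hcor, sub_sub_cancel_left, abs_neg, abs_mul, abs_mul, abs_two]
    calc 2 * |I| * |_| ≤ 2 * |I| * K₁ := by gcongr
      _ = _ := by ring
  · have h1 : pmin / k ≤ p t / k := by gcongr
    have h2 : pmin / (2 * k) = pmin / k / 2 := by rw [mul_comm, div_div]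
    have h3 : 0 < pmin / k := by positivity
    linarith [(abs_le.1 f₁).1]

end AcrobotParams

/-! ### Monotone crossings along rotations. -/

namespace AcrobotParams

variable (P : AcrobotParams)

/-- For small `I ≠ 0`, a rotation with positive momentum starting between the levels `w₁` and `w₂`
reaches `w₂` (if `I > 0`) or `w₁` (if `I < 0`); on the way it crosses `q = 0` finitely often, on
levels that are strictly monotone in time. -/
theorem exists_monotone_crossings {w₁ w₂ : ℝ} (h₁ : P.criticalSq < w₁) (h₂ : w₁ < w₂)
    (hmean : ∀ w ∈ Icc w₁ w₂,
      0 < ∫ θ in (0 : ℝ)..(2 * Real.pi), P.angularGain (Real.log (w - P.criticalSq)) θ) :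
    ∃ Istar, 0 < Istar ∧ ∀ I, I ≠ 0 → |I| ≤ Istar → ∀ q p : ℝ → ℝ,
      (∀ t, HasDerivAt q (P.qDot I (q t) (p t)) t) →
      (∀ t, HasDerivAt p (P.pDot I (q t) (p t)) t) →
      0 < p 0 → P.levelSq (q 0) (p 0) ∈ Icc w₁ w₂ →
      ∃ T, 0 ≤ T ∧ P.levelSq (q T) (p T) = (if 0 < I then w₂ else w₁) ∧
        {t | t ∈ Icc 0 T ∧ Real.cos (q t) = 1}.Finite ∧
        ∀ s ∈ Icc 0 T, ∀ t ∈ Icc 0 T, s < t → Real.cos (q s) = 1 → Real.cos (q t) = 1 →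
          I * P.levelSq (q s) (p s) < I * P.levelSq (q t) (p t) := by
  have hcont : ContinuousOn (fun w ↦ ∫ θ in (0 : ℝ)..(2 * Real.pi),
      P.angularGain (Real.log (w - P.criticalSq)) θ) (Ioi P.criticalSq) := by
    refine (continuous_integral_period P.continuous_angularGain _).comp_continuousOn
      (ContinuousOn.log (by fun_prop) fun w hw ↦ ?_)
    exact (sub_pos.2 hw).ne'
  obtain ⟨a, b, c, hca, haw, hwb, hc, hmean'⟩ := exists_Icc_enlargement hcont h₁ h₂.le hmean
  obtain ⟨δ, κ, K, hδ, hκ, hK, hdrift⟩ := P.exists_drift_bounds hca (by linarith) hc hmean'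
  -- The factor `4K` leaves a margin of two: the hitting argument needs `2K|I|` strictly below the
  -- gap between the given and the enlarged band.
  set Istar := min (δ / 2) (min ((w₁ - a) / (4 * K)) ((b - w₂) / (4 * K))) with hIstar
  have ha0 : 0 < w₁ - a := by linarith
  have hb0 : 0 < b - w₂ := by linarith
  refine ⟨Istar, by positivity, fun I hI0 hI q p hq hp hp0 hstart ↦ ?_⟩
  have hIδ : |I| < δ := by
    have := hI.trans (min_le_left _ _)
    linarith
  have hIa : 4 * K * |I| ≤ w₁ - a := by
    have := hI.trans ((min_le_right _ _).trans (min_le_left _ _))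
    rw [le_div_iff₀ (by positivity)] at this
    linarith
  have hIb : 4 * K * |I| ≤ b - w₂ := by
    have := hI.trans ((min_le_right _ _).trans (min_le_right _ _))
    rw [le_div_iff₀ (by positivity)] at this
    linarith
  have hqc : Continuous q := continuous_iff_continuousAt.2 fun t ↦ (hq t).continuousAt
  have hpc : Continuous p := continuous_iff_continuousAt.2 fun t ↦ (hp t).continuousAt
  set W : ℝ → ℝ := fun t ↦ P.levelSq (q t) (p t) with hW
  set V : ℝ → ℝ := fun t ↦ P.correctedLevelSq I (q t) (p t) with hV
  have hWc : Continuous W := by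
    simp only [hW, levelSq]
    fun_prop
  have hdrift' : ∀ τ, 0 ≤ τ → (∀ s ∈ Icc 0 τ, W s ∈ Icc a b) →
      (∃ v', HasDerivAt V v' τ ∧ κ * I ^ 2 ≤ I * v') ∧ |V τ - W τ| ≤ K * |I| ∧
      0 < P.qDot I (q τ) (p τ) := by
    intro τ hτ hband
    refine hdrift I hIδ q p τ (hq τ) (hp τ) ?_ (hband τ ⟨hτ, le_rfl⟩)
    refine pos_of_forall_ne_zero hpc hp0 hτ fun s hs h0 ↦ ?_
    have h1 := P.levelSq_sub_criticalSq_le_sq (q s) (p s)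
    have h2 := (hband s hs).1
    simp only [hW] at h2
    rw [h0] at h1 h2
    linarith
  have hIpos : 0 < |I| := abs_pos.2 hI0
  have hI2 : 0 < I ^ 2 := by positivity
  have hderiv : ∀ τ, 0 ≤ τ → (∀ s ∈ Icc 0 τ, W s ∈ Icc a b) →
      ∃ v', HasDerivAt (fun t ↦ I * V t) v' τ ∧ κ * I ^ 2 ≤ v' := fun τ hτ hband ↦ by
    obtain ⟨⟨v', h1, h2⟩, -⟩ := hdrift' τ hτ hband
    exact ⟨I * v', h1.const_mul I, h2⟩
  have hclose : ∀ τ, 0 ≤ τ → (∀ s ∈ Icc 0 τ, W s ∈ Icc a b) →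
      |I * V τ - I * W τ| ≤ K * I ^ 2 := fun τ hτ hband ↦ by
    rw [← mul_sub, abs_mul, ← sq_abs I]
    calc |I| * |V τ - W τ| ≤ |I| * (K * |I|) := by gcongr; exact (hdrift' τ hτ hband).2.1
      _ = K * |I| ^ 2 := by ring
  have hhit : ∃ T, 0 ≤ T ∧ W T = (if 0 < I then w₂ else w₁) ∧ ∀ s ∈ Icc 0 T, W s ∈ Icc a b := by
    rcases lt_or_gt_of_ne hI0 with hneg | hpos
    -- Multiplication by a negative `I` reverses the band, so the increasing quantity `I W` aims at
    -- `I w₁`.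
    · have hiff : ∀ x, I * x ∈ Icc (I * b) (I * a) ↔ x ∈ Icc a b := fun x ↦ by
        rw [mem_Icc, mem_Icc, mul_le_mul_left_of_neg hneg, mul_le_mul_left_of_neg hneg, and_comm]
      obtain ⟨T, hT, hWT, hband⟩ := exists_hitting_time (w := fun t ↦ I * W t)
        (v := fun t ↦ I * V t) (a' := I * b) (a := I * w₂) (b := I * w₁) (b' := I * a)
        (η := K * I ^ 2) (c := κ * I ^ 2) (by fun_prop)
        ⟨mul_le_mul_of_nonpos_left hstart.2 hneg.le, mul_le_mul_of_nonpos_left hstart.1 hneg.le⟩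
        (mul_le_mul_of_nonpos_left hwb.le hneg.le) (mul_le_mul_of_nonpos_left haw.le hneg.le)
        (by rw [abs_of_neg hneg] at hIb; nlinarith) (by positivity)
        (fun τ hτ hb ↦ hclose τ hτ fun s hs ↦ (hiff _).1 (hb s hs))
        (fun τ hτ hb ↦ hderiv τ hτ fun s hs ↦ (hiff _).1 (hb s hs))
      refine ⟨T, hT, ?_, fun s hs ↦ (hiff _).1 (hband s hs)⟩
      rw [if_neg hneg.not_gt]
      exact mul_left_cancel₀ hI0 hWT
    · have hiff : ∀ x, I * x ∈ Icc (I * a) (I * b) ↔ x ∈ Icc a b := fun x ↦ by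
        rw [mem_Icc, mem_Icc, mul_le_mul_iff_right₀ hpos, mul_le_mul_iff_right₀ hpos]
      obtain ⟨T, hT, hWT, hband⟩ := exists_hitting_time (w := fun t ↦ I * W t)
        (v := fun t ↦ I * V t) (a' := I * a) (a := I * w₁) (b := I * w₂) (b' := I * b)
        (η := K * I ^ 2) (c := κ * I ^ 2) (by fun_prop)
        ⟨mul_le_mul_of_nonneg_left hstart.1 hpos.le, mul_le_mul_of_nonneg_left hstart.2 hpos.le⟩
        (mul_le_mul_of_nonneg_left haw.le hpos.le) (mul_le_mul_of_nonneg_left hwb.le hpos.le)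
        (by rw [abs_of_pos hpos] at hIa; nlinarith) (by positivity)
        (fun τ hτ hb ↦ hclose τ hτ fun s hs ↦ (hiff _).1 (hb s hs))
        (fun τ hτ hb ↦ hderiv τ hτ fun s hs ↦ (hiff _).1 (hb s hs))
      refine ⟨T, hT, ?_, fun s hs ↦ (hiff _).1 (hband s hs)⟩
      rw [if_pos hpos]
      exact mul_left_cancel₀ hI0 hWT
  obtain ⟨T, hT, hWT, hband⟩ := hhit
  have hhist : ∀ τ ∈ Icc 0 T, ∀ s ∈ Icc 0 τ, W s ∈ Icc a b := fun τ hτ s hs ↦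
    hband s ⟨hs.1, hs.2.trans hτ.2⟩
  refine ⟨T, hT, hWT, ?_, ?_⟩
  · refine finite_setOf_cos_eq_one (strictMonoOn_of_deriv_pos (convex_Icc 0 T) hqc.continuousOn
      fun t ht ↦ ?_)
    rw [(hq t).deriv]
    have ht' := interior_subset ht
    exact (hdrift' t ht'.1 (hhist t ht')).2.2
  · intro s hs t ht hst hcs hct
    have h := add_mul_le_of_le_deriv (v := fun t ↦ I * V t)
      (fun τ hτ ↦ hderiv τ hτ.1 (hhist τ hτ)) hs ht hst.le
    simp only [hV, P.correctedLevelSq_of_cos_eq_one hcs,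
      P.correctedLevelSq_of_cos_eq_one hct] at h
    have : 0 < κ * I ^ 2 * (t - s) := mul_pos (by positivity) (sub_pos.2 hst)
    linarith

/-! ### Reflection symmetry and return to the cylinder. -/

theorem qDot_neg_neg (I q p : ℝ) : P.qDot I (-q) (-p) = -P.qDot I q p := by
  have h : P.legAngle I (-p) = -P.legAngle I p := by simp [legAngle]
  unfold qDot
  rw [h, Real.cos_neg, ← neg_add, Real.sin_neg, Real.sin_neg, ← neg_div]
  ring

theorem pDot_neg_neg (I q p : ℝ) : P.pDot I (-q) (-p) = -P.pDot I q p := by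
  have h : P.legAngle I (-p) = -P.legAngle I p := by simp [legAngle]
  unfold pDot
  rw [h, ← neg_add, Real.sin_neg, Real.sin_neg]
  ring

theorem levelSq_neg_neg (q p : ℝ) : P.levelSq (-q) (-p) = P.levelSq q p := by
  simp [levelSq]

theorem levelSq_eq_energy (q p : ℝ) :
    P.levelSq q p = 10 * P.m * P.l ^ 2 * P.energy ((q : Real.Angle), p) := by
  have hm := P.m_pos
  have hl := P.l_pos
  unfold levelSq energy
  rw [Real.Angle.cos_coe]
  field_simp
  ring

theorem criticalSq_eq_Rbar : P.criticalSq = 10 * P.m * P.l ^ 2 * P.Rbar := by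
  unfold criticalSq Rbar energy
  simp
  ring

/-- The crossing times of a curve form a finite sequence if they are finitely many. -/
theorem exists_isCrossingSequence {P : AcrobotParams} {x : ℝ → State} {T : ℝ}
    (hfin : {s | s ∈ Icc 0 T ∧ x s ∈ P.rotationSection}.Finite) :
    ∃ (n : ℕ) (t : Fin n → ℝ), P.IsCrossingSequence x T t :=
  ⟨hfin.toFinset.card, hfin.toFinset.orderEmbOfFin rfl,
    (hfin.toFinset.orderEmbOfFin rfl).strictMono, by
      rw [Finset.range_orderEmbOfFin, Finite.coe_toFinset]⟩

theorem isRotation_of_finite {P : AcrobotParams} {x : ℝ → State} {T : ℝ}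
    (hfin : {s | s ∈ Icc 0 T ∧ x s ∈ P.rotationSection}.Finite) : P.IsRotation x T := by
  refine ((hfin.image x).subset ?_).isDiscrete
  rintro _ ⟨⟨s, hs, rfl⟩, hx⟩
  exact ⟨s, ⟨hs, hx⟩, rfl⟩

/-- On the section, the squared norm of the state is the squared momentum level. -/
theorem stateNorm_eq_sqrt_levelSq {q p : ℝ} (h : ((q : Real.Angle), p) ∈ P.rotationSection) :
    stateNorm ((q : Real.Angle), p) = √(P.levelSq q p) := by
  have h0 : (q : Real.Angle) = 0 := h.2
  have hcos : Real.cos q = 1 := by rw [← Real.Angle.cos_coe, h0, Real.Angle.cos_zero]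
  unfold stateNorm levelSq
  rw [h0, hcos]
  simp

/-- Keeping the factor `I` in the final inequality lets one statement give both gain and loss:
dividing by `I` preserves or reverses the order according to its sign. -/
theorem exists_monotone_rotation {R₁ R₂ : ℝ} (hR₁ : P.Rbar < R₁) (hR₂ : R₁ < R₂)
    (hS : ∀ r ∈ Icc (Real.sqrt (10 * P.m * P.l ^ 2 * R₁)) (Real.sqrt (10 * P.m * P.l ^ 2 * R₂)),
      0 < P.S r) :
    ∃ Istar, 0 < Istar ∧ ∀ I, I ≠ 0 → |I| ≤ Istar → ∀ x₀ ∈ P.energyBand R₁ R₂,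
      ∀ x, P.IsSolution I x₀ x → ∃ T, 0 ≤ T ∧
        x T ∈ P.energyLevel (if 0 < I then R₂ else R₁) ∧ P.IsRotation x T ∧
        ∃ (n : ℕ) (t : Fin n → ℝ), P.IsCrossingSequence x T t ∧ ∀ i j, i < j →
          I * stateNorm (x (t i)) ^ 2 < I * stateNorm (x (t j)) ^ 2 := by
  have hm := P.m_pos
  have hl := P.l_pos
  have hk : 0 < 10 * P.m * P.l ^ 2 := by positivity
  set k := 10 * P.m * P.l ^ 2 with hkdef
  have hc : P.criticalSq = k * P.Rbar := P.criticalSq_eq_Rbar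
  have hc0 : 0 ≤ P.criticalSq := by have := P.g_pos; unfold criticalSq; positivity
  have hcw : P.criticalSq < k * R₁ := by rw [hc]; gcongr
  obtain ⟨Istar, hpos, hmain⟩ := P.exists_monotone_crossings (w₁ := k * R₁) (w₂ := k * R₂)
    hcw (by gcongr) (fun w hw ↦ by
      have hcw' : 60 * P.m ^ 2 * P.g * P.l ^ 3 < w := hcw.trans_le hw.1
      have h := P.integral_angularGain hcw'
      unfold criticalSq
      rw [h]
      exact mul_pos (Real.sqrt_pos.2 (hc0.trans_lt hcw'))
        (hS _ ⟨Real.sqrt_le_sqrt hw.1, Real.sqrt_le_sqrt hw.2⟩))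
  refine ⟨Istar, hpos, fun I hI0 hI x₀ hx₀ x hx ↦ ?_⟩
  obtain ⟨hx0, q, p, hxe, hq, hp⟩ := hx
  have hlev : ∀ t, P.levelSq (q t) (p t) = k * P.energy (x t) := fun t ↦ by
    rw [hxe]; exact P.levelSq_eq_energy _ _
  have hstart : P.levelSq (q 0) (p 0) ∈ Icc (k * R₁) (k * R₂) := by
    rw [hlev, hx0]
    exact ⟨mul_le_mul_of_nonneg_left hx₀.1 hk.le, mul_le_mul_of_nonneg_left hx₀.2 hk.le⟩
  -- Zero momentum would put the start at or below the critical level. So the sign of `p 0` is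
  -- definite, and the negative case is reflected to the positive one.
  have hp0 : p 0 ≠ 0 := by
    intro h0
    have h1 := P.levelSq_sub_criticalSq_le_sq (q 0) (p 0)
    rw [h0] at h1 hstart
    linarith [hstart.1]
  obtain ⟨T, hT, hWT, hfin, hmono⟩ : ∃ T, 0 ≤ T ∧
      P.levelSq (q T) (p T) = (if 0 < I then k * R₂ else k * R₁) ∧
        {t | t ∈ Icc 0 T ∧ Real.cos (q t) = 1}.Finite ∧
        ∀ s ∈ Icc 0 T, ∀ t ∈ Icc 0 T, s < t → Real.cos (q s) = 1 → Real.cos (q t) = 1 →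
          I * P.levelSq (q s) (p s) < I * P.levelSq (q t) (p t) := by
    rcases lt_or_gt_of_ne hp0 with hneg | hpos
    · have := hmain I hI0 hI (fun t ↦ -q t) (fun t ↦ -p t)
        (fun t ↦ by rw [qDot_neg_neg]; exact (hq t).neg)
        (fun t ↦ by rw [pDot_neg_neg]; exact (hp t).neg) (neg_pos.2 hneg)
        (by rwa [levelSq_neg_neg])
      simpa only [levelSq_neg_neg, Real.cos_neg] using this
    · exact hmain I hI0 hI q p hq hp hpos hstart
  have hcos : ∀ s, x s ∈ P.rotationSection → Real.cos (q s) = 1 := fun s hs ↦ by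
    have h0 : (q s : Real.Angle) = 0 := by have := hs.2; rwa [hxe] at this
    rw [← Real.Angle.cos_coe, h0, Real.Angle.cos_zero]
  have hfin' : {s | s ∈ Icc 0 T ∧ x s ∈ P.rotationSection}.Finite :=
    hfin.subset fun s hs ↦ ⟨hs.1, hcos s hs.2⟩
  obtain ⟨n, t, ht⟩ := exists_isCrossingSequence hfin'
  refine ⟨T, hT, ?_, isRotation_of_finite hfin', n, t, ht, fun i j hij ↦ ?_⟩
  · rw [hlev] at hWT
    change P.energy (x T) = _
    refine mul_left_cancel₀ hk.ne' ?_
    rw [hWT]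
    split_ifs <;> rfl
  · have hmem : ∀ i, t i ∈ Icc 0 T ∧ x (t i) ∈ P.rotationSection := fun i ↦ by
      have : t i ∈ range t := ⟨i, rfl⟩
      rwa [ht.2] at this
    have hsq : ∀ i, stateNorm (x (t i)) ^ 2 = P.levelSq (q (t i)) (p (t i)) := fun i ↦ by
      have h := (hmem i).2
      rw [hxe] at h ⊢
      rw [P.stateNorm_eq_sqrt_levelSq h, Real.sq_sqrt ((sq_nonneg _).trans (P.sq_le_levelSq _ _))]
    rw [hsq, hsq]
    exact hmono _ (hmem i).1 _ (hmem j).1 (ht.1 hij) (hcos _ (hmem i).2) (hcos _ (hmem j).2)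

theorem stateNorm_nonneg (x : State) : 0 ≤ stateNorm x := Real.sqrt_nonneg _

end AcrobotParams

end

theorem mainTheorem2 (P : AcrobotParams) (R₁ R₂ : ℝ) (hR₁ : P.Rbar < R₁) (hR₂ : R₁ < R₂)
    (hS : ∃ ε : ℝ, 0 < ε ∧
      ∀ r ∈ Set.Icc (Real.sqrt (10 * P.m * P.l ^ 2 * R₁)) (Real.sqrt (10 * P.m * P.l ^ 2 * R₂)),
        ε ≤ P.S r) :
    ∃ Istar : ℝ, 0 < Istar ∧
      (∀ I ∈ Set.Ioc 0 Istar, ∀ x₀ ∈ P.energyBand R₁ R₂,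
        (∃! x : ℝ → AcrobotParams.State, P.IsSolution I x₀ x) ∧
        ∀ x : ℝ → AcrobotParams.State, P.IsSolution I x₀ x →
          ∃ T : ℝ, 0 ≤ T ∧ x T ∈ P.energyLevel R₂ ∧ P.IsRotationGainingEnergy x T) ∧
      (∀ I ∈ Set.Ico (-Istar) 0, ∀ x₀ ∈ P.energyBand R₁ R₂,
        (∃! x : ℝ → AcrobotParams.State, P.IsSolution I x₀ x) ∧
        ∀ x : ℝ → AcrobotParams.State, P.IsSolution I x₀ x →
          ∃ T : ℝ, 0 ≤ T ∧ x T ∈ P.energyLevel R₁ ∧ P.IsRotationLosingEnergy x T) := by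
  obtain ⟨ε, hε, hS⟩ := hS
  obtain ⟨Istar, hpos, hmain⟩ := P.exists_monotone_rotation hR₁ hR₂
    fun r hr ↦ hε.trans_le (hS r hr)
  refine ⟨Istar, hpos, fun I hI x₀ hx₀ ↦ ⟨P.existsUnique_isSolution I x₀, fun x hx ↦ ?_⟩,
    fun I hI x₀ hx₀ ↦ ⟨P.existsUnique_isSolution I x₀, fun x hx ↦ ?_⟩⟩
  · obtain ⟨T, hT, hxT, hrot, n, t, ht, hmono⟩ :=
      hmain I hI.1.ne' (by rw [abs_of_pos hI.1]; exact hI.2) x₀ hx₀ x hx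
    rw [if_pos hI.1] at hxT
    refine ⟨T, hT, hxT, hrot, n, t, ht, fun i j hij ↦ ?_⟩
    exact lt_of_pow_lt_pow_left₀ 2 (AcrobotParams.stateNorm_nonneg _)
      (lt_of_mul_lt_mul_left (hmono i j hij) hI.1.le)
  · obtain ⟨T, hT, hxT, hrot, n, t, ht, hmono⟩ :=
      hmain I hI.2.ne (by rw [abs_of_neg hI.2]; linarith [hI.1]) x₀ hx₀ x hx
    rw [if_neg hI.2.not_gt] at hxT
    refine ⟨T, hT, hxT, hrot, n, t, ht, fun i j hij ↦ ?_⟩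
    exact lt_of_pow_lt_pow_left₀ 2 (AcrobotParams.stateNorm_nonneg _)
      ((mul_lt_mul_left_of_neg hI.2).1 (hmono i j hij))
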